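/- By a *solution* of the first Painlevé equation $y''=6y^2-x$ we mean a real-valued solution $y(x)$ considered on its interval of existence, i.e. on a nonempty open interval of $\mathbb R$ beyond which it does not extend as a real-valued solution; two solutions are the same if their intervals of existence and their values there agree. Writing $y(a)=v$ for a solution includes that $a$ lies in its interval of existence. For real numbers $x_0\le 0$, $y_0$, $y^0$ put $$Z(x_0,y_0,y^0)=\inf\{z\in\mathbb R:\ \text{there is a solution } y \text{ of } y''=6y^2-x \text{ with } y(x_0)=y_0 \text{ and } y(z)=y^0\}.$$ **Theorem.** Let $x_0\le 0$ and $y_0,y^0\in\mathbb R$. The set above is nonempty and bounded below, so that $Z(x_0,y_0,y^0)$ is a real number, and $Z(x_0,y_0,y^0)<x_0$. Moreover, for every $x_1<x_0$, the Dirichlet boundary value problem $$y''=6y^2-x,\qquad y(x_0)=y_0,\quad y(x_1)=y^0$$ has 1. no solution if $x_1<Z(x_0,y_0,y^0)$; 2. exactly one solution if $x_1=Z(x_0,y_0,y^0)$; 3. exactly two solutions if $Z(x_0,y_0,y^0)<x_1<x_0$. -/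

import Mathlib

/-- `y` satisfies the first Painlevé equation `y'' = 6 y² - x` at every point of `s`. -/
def SatisfiesP1On (y : ℝ → ℝ) (s : Set ℝ) : Prop :=
  ∀ x ∈ s, DifferentiableAt ℝ y x ∧ HasDerivAt (deriv y) (6 * y x ^ 2 - x) x

/-- A real solution of `y'' = 6 y² - x`, given on its interval of existence: a nonempty open
interval `dom` beyond which it does not extend as a solution. The values of `toFun` outside `dom`
have no meaning; they are set to `0`, so that two solutions are equal exactly when their intervals
of existence and their values there coincide. -/
@[ext]
structure P1Solution where
  dom : Set ℝ
  toFun : ℝ → ℝ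
  isOpen_dom : IsOpen dom
  isConnected_dom : IsConnected dom
  eq_zero_off_dom : ∀ x ∉ dom, toFun x = 0
  satisfies : SatisfiesP1On toFun dom
  maximal : ∀ (s : Set ℝ) (w : ℝ → ℝ), IsOpen s → IsConnected s → dom ⊆ s →
    SatisfiesP1On w s → Set.EqOn w toFun dom → s ⊆ dom

/-- The solution `y` is defined at `x` and has the value `v` there. -/
def P1Solution.PassesThrough (y : P1Solution) (x v : ℝ) : Prop :=
  x ∈ y.dom ∧ y.toFun x = v

/-- The abscissas at which solutions with `y(x₀) = y₀` take the value `b`. -/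
def P1LevelAbscissas (x₀ y₀ b : ℝ) : Set ℝ :=
  {z | ∃ y : P1Solution, y.PassesThrough x₀ y₀ ∧ y.PassesThrough z b}

/-- The function `Z(x₀, y₀, b) = inf {z : y(z) = b}`, over all solutions with `y(x₀) = y₀`. -/
noncomputable def P1Z (x₀ y₀ b : ℝ) : ℝ :=
  sInf (P1LevelAbscissas x₀ y₀ b)

/-- The solutions of the Dirichlet problem `y(x₀) = y₀`, `y(x₁) = b`. -/
def P1DirichletSolutions (x₀ y₀ x₁ b : ℝ) : Set P1Solution :=
  {y | y.PassesThrough x₀ y₀ ∧ y.PassesThrough x₁ b}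

/-! Put t = x₀ - x and u(t) = y(x₀ - t). The equation becomes u'' = 6u² + t + c with c = -x₀ ≥ 0, so
u is convex for t ≥ 0, and the Dirichlet problem asks for the slopes m = u'(0) with u(T) = b, where
T = x₀ - x₁.

At most two solutions: for two solutions of the equation from the same initial value, let d be their
difference and s their mean. Then d'' = 12 s d and s'' ≥ 6s². If d vanishes at 0 and next at t₀,
then s' > 0 at t₀ (`mean_deriv_pos_of_consecutive_zeros`), and from there on |d| increases
(`deriv_pos_of_linearization`); so two solutions meet at most once after 0. A Wronskian of the
successive differences of three solutions (`ne_of_ordered`) then shows that a slope strictly between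
two slopes solving the Dirichlet problem gives u(T) < b (`lt_of_between`). The middle one of three
solutions would contradict this.

Existence: the condition u(T) ≤ b bounds T, and bounds m while T stays in a compact subset of (0,
∞). Hence the supremum T₀ of the solvable lengths is finite and, by compactness, attained. A
solution below b returns to b later, so none is below b at T₀; by `lt_of_between` the solution at T₀
is unique. For T < T₀ some slope undershoots b (`exists_undershoot`), by convexity if y₀ < b and
otherwise by comparison with a lowered time shift of the solution for T₀. Slopes of large modulus of
either sign end above b or blow up before T, so connectedness of a half-line of slopes gives a
solution on each side (`exists_two_of_lt`). Thus Z = x₀ - T₀. -/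

open Set Filter Topology

/-! ### The linear equation `d'' = q d` -/

section LinearEquation

variable {d δ q : ℝ → ℝ} {a b C : ℝ}

theorem hasDerivAt_energy {t : ℝ} (hd : HasDerivAt d (δ t) t) (hδ : HasDerivAt δ (q t * d t) t) :
    HasDerivAt (fun t ↦ d t ^ 2 + δ t ^ 2) (2 * (1 + q t) * (d t * δ t)) t := by
  refine ((hd.pow 2).add (hδ.pow 2)).congr_deriv ?_
  simp
  ring

theorem abs_energy_deriv_le {x y r : ℝ} (hr : |r| ≤ C) :
    |2 * (1 + r) * (x * y)| ≤ (1 + C) * (x ^ 2 + y ^ 2) := by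
  have h1 : |1 + r| ≤ 1 + C := (abs_add_le _ _).trans (by simpa using hr)
  have h2 : 2 * |x * y| ≤ x ^ 2 + y ^ 2 := by
    rw [abs_mul, ← sq_abs x, ← sq_abs y]
    nlinarith [sq_nonneg (|x| - |y|)]
  calc |2 * (1 + r) * (x * y)| = |1 + r| * (2 * |x * y|) := by
        rw [abs_mul, abs_mul, abs_two]; ring
    _ ≤ (1 + C) * (x ^ 2 + y ^ 2) := by gcongr; exact (abs_nonneg _).trans h1

theorem hasDerivAt_exp_mul_energy (k : ℝ) {t : ℝ} (hd : HasDerivAt d (δ t) t)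
    (hδ : HasDerivAt δ (q t * d t) t) :
    HasDerivAt (fun t ↦ Real.exp (k * t) * (d t ^ 2 + δ t ^ 2))
      (Real.exp (k * t) * (k * (d t ^ 2 + δ t ^ 2) + 2 * (1 + q t) * (d t * δ t))) t := by
  have h := ((hasDerivAt_id t).const_mul k).exp.mul (hasDerivAt_energy hd hδ)
  refine h.congr_deriv ?_
  simp
  ring

/-- Grönwall: the energy grows at rate at most 1 + C, so it is nonincreasing after multiplication by
exp(-(1 + C)t). -/
theorem energy_le_forward (hab : a ≤ b) (hd : ∀ t ∈ Icc a b, HasDerivAt d (δ t) t)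
    (hδ : ∀ t ∈ Icc a b, HasDerivAt δ (q t * d t) t) (hq : ∀ t ∈ Icc a b, |q t| ≤ C) :
    d b ^ 2 + δ b ^ 2 ≤ Real.exp ((1 + C) * (b - a)) * (d a ^ 2 + δ a ^ 2) := by
  have hder := fun t (ht : t ∈ Icc a b) ↦ hasDerivAt_exp_mul_energy (-(1 + C)) (hd t ht) (hδ t ht)
  have hanti := antitoneOn_of_hasDerivWithinAt_nonpos (convex_Icc a b)
    (fun t ht ↦ (hder t ht).continuousAt.continuousWithinAt)
    (fun t ht ↦ (hder t (interior_subset ht)).hasDerivWithinAt) (fun t ht ↦ by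
      have h := abs_le.1 (abs_energy_deriv_le (x := d t) (y := δ t) (hq t (interior_subset ht)))
      exact mul_nonpos_of_nonneg_of_nonpos (Real.exp_pos _).le (by linarith [h.2]))
  have h := hanti (left_mem_Icc.2 hab) (right_mem_Icc.2 hab) hab
  simp only at h
  have h2 := mul_le_mul_of_nonneg_left h (Real.exp_pos ((1 + C) * b)).le
  rw [← mul_assoc, ← mul_assoc, ← Real.exp_add, ← Real.exp_add] at h2
  ring_nf at h2 ⊢
  simpa using h2

theorem energy_le_backward (hab : a ≤ b) (hd : ∀ t ∈ Icc a b, HasDerivAt d (δ t) t)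
    (hδ : ∀ t ∈ Icc a b, HasDerivAt δ (q t * d t) t) (hq : ∀ t ∈ Icc a b, |q t| ≤ C) :
    d a ^ 2 + δ a ^ 2 ≤ Real.exp ((1 + C) * (b - a)) * (d b ^ 2 + δ b ^ 2) := by
  have hder := fun t (ht : t ∈ Icc a b) ↦ hasDerivAt_exp_mul_energy (1 + C) (hd t ht) (hδ t ht)
  have hmono := monotoneOn_of_hasDerivWithinAt_nonneg (convex_Icc a b)
    (fun t ht ↦ (hder t ht).continuousAt.continuousWithinAt)
    (fun t ht ↦ (hder t (interior_subset ht)).hasDerivWithinAt) (fun t ht ↦ by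
      have h := abs_le.1 (abs_energy_deriv_le (x := d t) (y := δ t) (hq t (interior_subset ht)))
      exact mul_nonneg (Real.exp_pos _).le (by linarith [h.1]))
  have h := hmono (left_mem_Icc.2 hab) (right_mem_Icc.2 hab) hab
  simp only at h
  have h2 := mul_le_mul_of_nonneg_left h (Real.exp_pos (-(1 + C) * a)).le
  rw [← mul_assoc, ← mul_assoc, ← Real.exp_add, ← Real.exp_add] at h2
  ring_nf at h2 ⊢
  simpa using h2

/-- A solution of `d'' = q d` with `q` bounded which has zero Cauchy data at one end of an interval
has zero Cauchy data at the other end. -/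
theorem cauchyData_eq_zero_iff (hab : a ≤ b) (hd : ∀ t ∈ Icc a b, HasDerivAt d (δ t) t)
    (hδ : ∀ t ∈ Icc a b, HasDerivAt δ (q t * d t) t) (hq : ∀ t ∈ Icc a b, |q t| ≤ C) :
    (d a = 0 ∧ δ a = 0) ↔ (d b = 0 ∧ δ b = 0) := by
  have h1 := energy_le_forward hab hd hδ hq
  have h2 := energy_le_backward hab hd hδ hq
  constructor
  · rintro ⟨h3, h4⟩
    rw [h3, h4] at h1
    constructor <;> nlinarith [sq_nonneg (d b), sq_nonneg (δ b)]
  · rintro ⟨h3, h4⟩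
    rw [h3, h4] at h2
    constructor <;> nlinarith [sq_nonneg (d a), sq_nonneg (δ a)]

end LinearEquation

/-! ### Cauchy problem for the first Painlevé equation -/

theorem SatisfiesP1On.mono {y : ℝ → ℝ} {s t : Set ℝ} (h : SatisfiesP1On y t) (hst : s ⊆ t) :
    SatisfiesP1On y s := fun x hx ↦ h x (hst hx)

theorem SatisfiesP1On.of_hasDerivAt {w g : ℝ → ℝ} {s : Set ℝ} (hs : IsOpen s)
    (hw : ∀ x ∈ s, HasDerivAt w (g x) x) (hg : ∀ x ∈ s, HasDerivAt g (6 * w x ^ 2 - x) x) :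
    SatisfiesP1On w s := by
  intro x hx
  refine ⟨(hw x hx).differentiableAt, (hg x hx).congr_of_eventuallyEq ?_⟩
  filter_upwards [hs.mem_nhds hx] with z hz using (hw z hz).deriv

theorem SatisfiesP1On.congr {w y : ℝ → ℝ} {s : Set ℝ} (hs : IsOpen s) (hy : SatisfiesP1On y s)
    (h : EqOn w y s) : SatisfiesP1On w s := by
  intro x hx
  have hev : w =ᶠ[𝓝 x] y := by filter_upwards [hs.mem_nhds hx] with z hz using h hz
  refine ⟨(hy x hx).1.congr_of_eventuallyEq hev, ?_⟩
  rw [h hx]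
  exact (hy x hx).2.congr_of_eventuallyEq hev.deriv

theorem SatisfiesP1On.hasDerivAt {y : ℝ → ℝ} {s : Set ℝ} (hy : SatisfiesP1On y s) {x : ℝ}
    (hx : x ∈ s) : HasDerivAt y (deriv y x) x := (hy x hx).1.hasDerivAt

theorem SatisfiesP1On.continuousOn {y : ℝ → ℝ} {s : Set ℝ} (hy : SatisfiesP1On y s) :
    ContinuousOn y s := fun _ hx ↦ (hy.hasDerivAt hx).continuousAt.continuousWithinAt

theorem SatisfiesP1On.cauchyData_eq_iff {w y : ℝ → ℝ} {a b : ℝ} (hab : a ≤ b)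
    (hw : SatisfiesP1On w (Icc a b)) (hy : SatisfiesP1On y (Icc a b)) :
    (w a = y a ∧ deriv w a = deriv y a) ↔ (w b = y b ∧ deriv w b = deriv y b) := by
  have hcont : ContinuousOn (fun x ↦ 6 * (w x + y x)) (Icc a b) :=
    (hw.continuousOn.add hy.continuousOn).const_mul 6 |>.congr fun _ _ ↦ rfl
  obtain ⟨C, hC⟩ := isCompact_Icc.exists_bound_of_continuousOn hcont
  have h := cauchyData_eq_zero_iff (d := fun x ↦ w x - y x)
    (δ := fun x ↦ deriv w x - deriv y x) (q := fun x ↦ 6 * (w x + y x)) hab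
    (fun t ht ↦ (hw.hasDerivAt ht).sub (hy.hasDerivAt ht))
    (fun t ht ↦ ((hw t ht).2.sub (hy t ht).2).congr_deriv (by ring)) hC
  simpa only [sub_eq_zero] using h

theorem SatisfiesP1On.eqOn_of_cauchyData_eq {w y : ℝ → ℝ} {s : Set ℝ} [hs : s.OrdConnected]
    (hw : SatisfiesP1On w s) (hy : SatisfiesP1On y s) {p : ℝ} (hp : p ∈ s) (h0 : w p = y p)
    (h1 : deriv w p = deriv y p) : EqOn w y s := by
  intro x hx
  rcases le_total p x with h | h
  · exact ((SatisfiesP1On.cauchyData_eq_iff h (hw.mono (hs.out hp hx))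
      (hy.mono (hs.out hp hx))).1 ⟨h0, h1⟩).1
  · exact ((SatisfiesP1On.cauchyData_eq_iff h (hw.mono (hs.out hx hp))
      (hy.mono (hs.out hx hp))).2 ⟨h0, h1⟩).1

/-- Local existence, with a uniform time of existence for Cauchy data near given ones. -/
theorem exists_satisfiesP1On_Ioo (x a v : ℝ) :
    ∃ r > 0, ∃ ε > 0, ∀ x' a' v' : ℝ, |x' - x| ≤ r → |a' - a| ≤ r → |v' - v| ≤ r →
      ∃ w : ℝ → ℝ, SatisfiesP1On w (Ioo (x' - ε) (x' + ε)) ∧ w x' = a' ∧ deriv w x' = v' := by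
  -- The system is made autonomous in (x, y, y'), so that a ball of initial data also covers nearby
  -- base points. That the first component is t + x' has to be recovered afterwards.
  let f : ℝ × ℝ × ℝ → ℝ × ℝ × ℝ := fun z ↦ (1, z.2.2, 6 * z.2.1 ^ 2 - z.1)
  have hf : ContDiffAt ℝ 1 f (x, a, v) := by
    apply ContDiff.contDiffAt
    fun_prop
  obtain ⟨r, hr, ε, hε, H⟩ :=
    hf.exists_forall_mem_closedBall_exists_eq_forall_mem_Ioo_hasDerivAt 0
  refine ⟨r, hr, ε, hε, fun x' a' v' hx ha hv ↦ ?_⟩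
  obtain ⟨α, hα0, hα⟩ := H (x', a', v') (by
    simp only [Metric.mem_closedBall, Prod.dist_eq, Real.dist_eq, max_le_iff]
    exact ⟨hx, ha, hv⟩)
  have h1 : ∀ t ∈ Ioo (0 - ε) (0 + ε), HasDerivAt (fun t ↦ (α t).1) 1 t := fun t ht ↦ (hα t ht).fst
  have h2 : ∀ t ∈ Ioo (0 - ε) (0 + ε), HasDerivAt (fun t ↦ (α t).2.1) (α t).2.2 t :=
    fun t ht ↦ (hα t ht).snd.fst
  have h3 : ∀ t ∈ Ioo (0 - ε) (0 + ε),
      HasDerivAt (fun t ↦ (α t).2.2) (6 * (α t).2.1 ^ 2 - (α t).1) t :=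
    fun t ht ↦ (hα t ht).snd.snd
  have h0 : (0 : ℝ) ∈ Ioo (0 - ε) (0 + ε) := ⟨by linarith, by linarith⟩
  have hfst : ∀ t ∈ Ioo (0 - ε) (0 + ε), (α t).1 = t + x' := by
    intro t ht
    have h := (convex_Ioo (0 - ε) (0 + ε)).is_const_of_fderivWithin_eq_zero (𝕜 := ℝ)
      (f := fun t ↦ (α t).1 - t)
      (fun t ht ↦ ((h1 t ht).sub (hasDerivAt_id t)).differentiableAt.differentiableWithinAt)
      (fun t ht ↦ by
        have h : HasDerivAt (fun t ↦ (α t).1 - t) 0 t :=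
          ((h1 t ht).sub (hasDerivAt_id t)).congr_deriv (by simp)
        rw [fderivWithin_of_isOpen isOpen_Ioo ht]
        ext
        simpa using h.deriv) ht h0
    simp only [hα0] at h
    linarith
  have hmem : ∀ z ∈ Ioo (x' - ε) (x' + ε), z - x' ∈ Ioo (0 - ε) (0 + ε) :=
    fun z hz ↦ ⟨by linarith [hz.1], by linarith [hz.2]⟩
  have hw : ∀ z ∈ Ioo (x' - ε) (x' + ε),
      HasDerivAt (fun z ↦ (α (z - x')).2.1) (α (z - x')).2.2 z :=
    fun z hz ↦ (h2 _ (hmem z hz)).comp_sub_const z x'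
  refine ⟨fun z ↦ (α (z - x')).2.1, SatisfiesP1On.of_hasDerivAt isOpen_Ioo hw ?_, ?_, ?_⟩
  · intro z hz
    have h := (h3 _ (hmem z hz)).comp_sub_const z x'
    rw [hfst _ (hmem z hz), sub_add_cancel] at h
    exact h
  · simp [hα0]
  · rw [(hw x' ⟨by linarith, by linarith⟩).deriv]
    simp [hα0]

namespace P1Solution

instance ordConnected_dom (y : P1Solution) : y.dom.OrdConnected :=
  y.isConnected_dom.isPreconnected.ordConnected

/-- A local solution with the Cauchy data of `y` at one point is a restriction of `y`. -/
theorem subset_dom_and_eqOn (y : P1Solution) {w : ℝ → ℝ} {s : Set ℝ} (hs : IsOpen s)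
    (hc : IsPreconnected s) (hw : SatisfiesP1On w s) {p : ℝ} (hps : p ∈ s) (hp : p ∈ y.dom)
    (h0 : w p = y.toFun p) (h1 : deriv w p = deriv y.toFun p) :
    s ⊆ y.dom ∧ EqOn w y.toFun s := by
  classical
  have hso : s.OrdConnected := hc.ordConnected
  have hint : EqOn w y.toFun (s ∩ y.dom) := by
    have : (s ∩ y.dom).OrdConnected := hso.inter y.ordConnected_dom
    exact SatisfiesP1On.eqOn_of_cauchyData_eq (hw.mono inter_subset_left)
      (y.satisfies.mono inter_subset_right) ⟨hps, hp⟩ h0 h1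
  let g : ℝ → ℝ := fun x ↦ if x ∈ y.dom then y.toFun x else w x
  have hgy : EqOn g y.toFun y.dom := fun x hx ↦ if_pos hx
  have hgw : EqOn g w s := by
    intro x hx
    by_cases h : x ∈ y.dom
    · rw [hgy h, hint ⟨hx, h⟩]
    · exact if_neg h
  have hsub := y.maximal (s ∪ y.dom) g (hs.union y.isOpen_dom)
    ⟨⟨p, Or.inl hps⟩, hc.union p hps hp y.isConnected_dom.isPreconnected⟩ subset_union_right
    (fun x hx ↦ hx.elim (fun h ↦ hw.congr hs hgw x h)
      (fun h ↦ y.satisfies.congr y.isOpen_dom hgy x h)) hgy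
  have hsd : s ⊆ y.dom := subset_union_left.trans hsub
  exact ⟨hsd, fun x hx ↦ hint ⟨hx, hsd hx⟩⟩

theorem ext_of_cauchyData {y z : P1Solution} {p : ℝ} (hy : p ∈ y.dom) (hz : p ∈ z.dom)
    (h0 : y.toFun p = z.toFun p) (h1 : deriv y.toFun p = deriv z.toFun p) : y = z := by
  obtain ⟨h2, h3⟩ := z.subset_dom_and_eqOn y.isOpen_dom y.isConnected_dom.isPreconnected
    y.satisfies hy hz h0 h1
  obtain ⟨h4, -⟩ := y.subset_dom_and_eqOn z.isOpen_dom z.isConnected_dom.isPreconnected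
    z.satisfies hz hy h0.symm h1.symm
  have hdom : y.dom = z.dom := h2.antisymm h4
  refine P1Solution.ext hdom (funext fun x ↦ ?_)
  by_cases hx : x ∈ y.dom
  · exact h3 hx
  · rw [y.eq_zero_off_dom x hx, z.eq_zero_off_dom x (hdom ▸ hx)]

/-- Every Cauchy problem has a solution on a maximal interval. -/
theorem exists_cauchyData (p a v : ℝ) :
    ∃ y : P1Solution, p ∈ y.dom ∧ y.toFun p = a ∧ deriv y.toFun p = v := by
  classical
  -- Local solutions with the prescribed data agree on overlaps, hence glue on the union of their
  -- domains; the union is maximal because every extension of it again satisfies `R`.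
  let R : Set ℝ → (ℝ → ℝ) → Prop := fun s w ↦
    IsOpen s ∧ IsPreconnected s ∧ p ∈ s ∧ SatisfiesP1On w s ∧ w p = a ∧ deriv w p = v
  have hagree : ∀ {s t w z}, R s w → R t z → EqOn w z (s ∩ t) := by
    rintro s t w z ⟨-, hs, hps, hw, hw0, hw1⟩ ⟨-, ht, hpt, hz, hz0, hz1⟩
    have : (s ∩ t).OrdConnected := hs.ordConnected.inter ht.ordConnected
    exact SatisfiesP1On.eqOn_of_cauchyData_eq (hw.mono inter_subset_left)
      (hz.mono inter_subset_right) ⟨hps, hpt⟩ (hw0.trans hz0.symm) (hw1.trans hz1.symm)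
  let dom : Set ℝ := ⋃₀ {s | ∃ w, R s w}
  have hdom : ∀ x : ℝ, x ∈ dom → ∃ s w, R s w ∧ x ∈ s := by
    rintro x ⟨s, ⟨w, hw⟩, hx⟩
    exact ⟨s, w, hw, hx⟩
  choose! S W hSW hxS using hdom
  let f : ℝ → ℝ := fun x ↦ if x ∈ dom then W x x else 0
  have hsub : ∀ {s w}, R s w → s ⊆ dom := fun {s w} h ↦ subset_sUnion_of_mem ⟨w, h⟩
  have hf : ∀ {s w}, R s w → EqOn f w s := by
    intro s w h x hx
    have hxd := hsub h hx
    rw [show f x = W x x from if_pos hxd]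
    exact hagree (hSW x hxd) h ⟨hxS x hxd, hx⟩
  have hopen : IsOpen dom := isOpen_sUnion fun s ⟨_, hw⟩ ↦ hw.1
  have hconn : IsPreconnected dom :=
    isPreconnected_sUnion p _ (fun s ⟨_, hw⟩ ↦ hw.2.2.1) (fun s ⟨_, hw⟩ ↦ hw.2.1)
  obtain ⟨r, hr, ε, hε, H⟩ := exists_satisfiesP1On_Ioo p a v
  obtain ⟨w₀, hw₀, hw₀0, hw₀1⟩ := H p a v (by simpa using hr.le) (by simpa using hr.le)
    (by simpa using hr.le)
  have hp₀ : p ∈ Ioo (p - ε) (p + ε) := ⟨by linarith, by linarith⟩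
  have hR₀ : R (Ioo (p - ε) (p + ε)) w₀ :=
    ⟨isOpen_Ioo, isPreconnected_Ioo, hp₀, hw₀, hw₀0, hw₀1⟩
  have hpd : p ∈ dom := hsub hR₀ hp₀
  have hfev : f =ᶠ[𝓝 p] w₀ := by
    filter_upwards [isOpen_Ioo.mem_nhds hp₀] with z hz using hf hR₀ hz
  have hf0 : f p = a := (hf hR₀ hp₀).trans hw₀0
  have hf1 : deriv f p = v := hfev.deriv_eq.trans hw₀1
  refine ⟨⟨dom, f, hopen, ⟨⟨p, hpd⟩, hconn⟩, fun x hx ↦ if_neg hx, ?_, ?_⟩, hpd, hf0, hf1⟩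
  · intro x hx
    have h := hSW x hx
    exact h.2.2.2.1.congr h.1 (hf h) x (hxS x hx)
  · intro s w hs hc hds hw heq
    have hev : w =ᶠ[𝓝 p] f := by
      filter_upwards [hopen.mem_nhds hpd] with z hz using heq hz
    exact hsub (w := w) ⟨hs, hc.isPreconnected, hds hpd, hw, (heq hpd).trans hf0,
      hev.deriv_eq.trans hf1⟩

/-- A solution with bounded Cauchy data to the right of `q` is defined at `q`. -/
theorem mem_dom_of_bounded_right (y : P1Solution) {p q K : ℝ} (hqp : q < p)
    (hsub : Ioc q p ⊆ y.dom)
    (hK : ∀ x ∈ Ioc q p, |y.toFun x| ≤ K ∧ |deriv y.toFun x| ≤ K) : q ∈ y.dom := by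
  let z : ℕ → ℝ := fun n ↦ q + (p - q) / (n + 1)
  have hz : ∀ n, z n ∈ Ioc q p := by
    intro n
    have hn : (0 : ℝ) < n + 1 := by positivity
    have h1 : 0 < (p - q) / (n + 1) := div_pos (by linarith) hn
    have h2 : (p - q) / (n + 1) ≤ p - q := div_le_self (by linarith) (by linarith)
    exact ⟨by simp only [z]; linarith, by simp only [z]; linarith⟩
  have hzlim : Tendsto z atTop (𝓝 q) := by
    have h : Tendsto (fun n : ℕ ↦ q + (p - q) * (1 / ((n : ℝ) + 1))) atTop (𝓝 (q + (p - q) * 0)) :=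
      (tendsto_one_div_add_atTop_nhds_zero_nat.const_mul _).const_add _
    simpa [z, div_eq_mul_inv] using h
  have hbox : IsCompact (Icc (-K) K ×ˢ Icc (-K) K) := isCompact_Icc.prod isCompact_Icc
  -- The Cauchy data along `z n → q` accumulate at some `(a, v)`. Near it the time of existence is
  -- uniform, so a restart from a point closer than `ε` to `q` reaches past `q`.
  obtain ⟨⟨a, v⟩, -, φ, hφ, hlim⟩ := hbox.tendsto_subseq
    (x := fun n ↦ (y.toFun (z n), deriv y.toFun (z n)))
    (fun n ↦ ⟨abs_le.1 (hK _ (hz n)).1, abs_le.1 (hK _ (hz n)).2⟩)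
  obtain ⟨r, hr, ε, hε, H⟩ := exists_satisfiesP1On_Ioo q a v
  have e1 : ∀ᶠ n in atTop, |z (φ n) - q| < min r ε := by
    simpa [Real.dist_eq] using
      Metric.tendsto_nhds.1 (hzlim.comp hφ.tendsto_atTop) (min r ε) (lt_min hr hε)
  have e2 : ∀ᶠ n in atTop, |y.toFun (z (φ n)) - a| < r := by
    simpa [Real.dist_eq] using Metric.tendsto_nhds.1 ((continuous_fst.tendsto _).comp hlim) r hr
  have e3 : ∀ᶠ n in atTop, |deriv y.toFun (z (φ n)) - v| < r := by
    simpa [Real.dist_eq] using Metric.tendsto_nhds.1 ((continuous_snd.tendsto _).comp hlim) r hr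
  obtain ⟨n, h1, h2, h3⟩ := (e1.and (e2.and e3)).exists
  obtain ⟨h1r, h1ε⟩ := lt_min_iff.1 h1
  obtain ⟨w, hw, hw0, hw1⟩ := H _ _ _ h1r.le h2.le h3.le
  have h := y.subset_dom_and_eqOn isOpen_Ioo isPreconnected_Ioo hw
    (p := z (φ n)) ⟨by linarith, by linarith⟩ (hsub (hz _)) hw0 hw1
  have h4 := abs_lt.1 h1ε
  exact h.1 ⟨by linarith [h4.2], by linarith [h4.1]⟩

end P1Solution

/-! ### Calculus on a compact interval -/

section Calculus

variable {u v g : ℝ → ℝ} {a b k : ℝ}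

theorem monotoneOn_Icc_of_hasDerivAt_nonneg (hu : ∀ t ∈ Icc a b, HasDerivAt u (v t) t)
    (hv : ∀ t ∈ Icc a b, 0 ≤ v t) : MonotoneOn u (Icc a b) :=
  monotoneOn_of_hasDerivWithinAt_nonneg (convex_Icc a b)
    (fun t ht ↦ (hu t ht).continuousAt.continuousWithinAt)
    (fun t ht ↦ (hu t (interior_subset ht)).hasDerivWithinAt)
    (fun t ht ↦ hv t (interior_subset ht))

theorem lt_of_hasDerivAt_pos (hab : a < b) (hu : ∀ t ∈ Icc a b, HasDerivAt u (v t) t)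
    (hv : ∀ t ∈ Ioo a b, 0 < v t) : u a < u b := by
  refine strictMonoOn_of_hasDerivWithinAt_pos (convex_Icc a b) (f' := v)
    (fun t ht ↦ (hu t ht).continuousAt.continuousWithinAt)
    (fun t ht ↦ (hu t (interior_subset ht)).hasDerivWithinAt) (fun t ht ↦ hv t ?_)
    (left_mem_Icc.2 hab.le) (right_mem_Icc.2 hab.le) hab
  rwa [interior_Icc] at ht

theorem add_mul_sub_le (hab : a ≤ b) (hu : ∀ t ∈ Icc a b, HasDerivAt u (v t) t)
    (hv : ∀ t ∈ Icc a b, k ≤ v t) : u a + k * (b - a) ≤ u b := by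
  have h := monotoneOn_Icc_of_hasDerivAt_nonneg (u := fun t ↦ u t - k * t)
    (fun t ht ↦ (hu t ht).sub ((hasDerivAt_id t).const_mul k))
    (fun t ht ↦ by simpa using hv t ht) (left_mem_Icc.2 hab) (right_mem_Icc.2 hab) hab
  simp only at h
  linarith

theorem le_add_mul_sub (hab : a ≤ b) (hu : ∀ t ∈ Icc a b, HasDerivAt u (v t) t)
    (hv : ∀ t ∈ Icc a b, v t ≤ k) : u b ≤ u a + k * (b - a) := by
  have h := add_mul_sub_le (u := fun t ↦ -u t) (k := -k) hab (fun t ht ↦ (hu t ht).neg)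
    (fun t ht ↦ neg_le_neg (hv t ht))
  linarith

theorem tangent_left_le (hab : a ≤ b) (hu : ∀ t ∈ Icc a b, HasDerivAt u (v t) t)
    (hv : MonotoneOn v (Icc a b)) : u a + v a * (b - a) ≤ u b :=
  add_mul_sub_le hab hu fun _ ht ↦ hv (left_mem_Icc.2 hab) ht ht.1

theorem tangent_right_le (hab : a ≤ b) (hu : ∀ t ∈ Icc a b, HasDerivAt u (v t) t)
    (hv : MonotoneOn v (Icc a b)) : u b ≤ u a + v b * (b - a) :=
  le_add_mul_sub hab hu fun _ ht ↦ hv ht (right_mem_Icc.2 hab) ht.2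

theorem quadratic_le (hab : a ≤ b) (hu : ∀ t ∈ Icc a b, HasDerivAt u (v t) t)
    (hv : ∀ t ∈ Icc a b, HasDerivAt v (g t) t) (hg : ∀ t ∈ Icc a b, k ≤ g t) :
    u a + v a * (b - a) + k * (b - a) ^ 2 / 2 ≤ u b := by
  have h := add_mul_sub_le (u := fun t ↦ u t - k * (t - a) ^ 2 / 2)
    (v := fun t ↦ v t - k * (t - a)) (k := v a) hab
    (fun t ht ↦ ((hu t ht).sub (((((hasDerivAt_id t).sub_const a).pow 2).const_mul k).div_const
      2)).congr_deriv (by simp; ring))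
    (fun t ht ↦ by
      have := add_mul_sub_le ht.1 (fun r hr ↦ hv r ⟨hr.1, hr.2.trans ht.2⟩)
        (fun r hr ↦ hg r ⟨hr.1, hr.2.trans ht.2⟩)
      linarith)
  simp only [sub_self] at h
  linarith

theorem le_quadratic (hab : a ≤ b) (hu : ∀ t ∈ Icc a b, HasDerivAt u (v t) t)
    (hv : ∀ t ∈ Icc a b, HasDerivAt v (g t) t) (hg : ∀ t ∈ Icc a b, g t ≤ k) :
    u b ≤ u a + v a * (b - a) + k * (b - a) ^ 2 / 2 := by
  have h := quadratic_le (u := fun t ↦ -u t) (v := fun t ↦ -v t) (k := -k) hab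
    (fun t ht ↦ (hu t ht).neg) (fun t ht ↦ (hv t ht).neg) (fun t ht ↦ neg_le_neg (hg t ht))
  linarith

theorem hasDerivAt_comp_neg_of_forall (hu : ∀ t ∈ Icc a b, HasDerivAt u (v t) t) :
    ∀ t ∈ Icc (-b) (-a), HasDerivAt (fun t ↦ u (-t)) (-v (-t)) t := by
  intro t ht
  have h := (hu (-t) ⟨by linarith [ht.2], by linarith [ht.1]⟩).comp t (hasDerivAt_neg t)
  exact h.congr_deriv (by simp)

theorem hasDerivAt_neg_comp_neg_of_forall (hv : ∀ t ∈ Icc a b, HasDerivAt v (g t) t) :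
    ∀ t ∈ Icc (-b) (-a), HasDerivAt (fun t ↦ -v (-t)) (g (-t)) t := fun t ht ↦
  (hasDerivAt_comp_neg_of_forall hv t ht).neg.congr_deriv (by simp)

/-- A function which is positive just after `a` and nonpositive at `b` has a first zero. -/
theorem exists_first_zero (hab : a < b) (hc : ContinuousOn u (Icc a b))
    (hev : ∀ᶠ t in 𝓝[>] a, 0 < u t) (hb : u b ≤ 0) :
    ∃ t₀ ∈ Ioc a b, u t₀ = 0 ∧ ∀ t ∈ Ioo a t₀, 0 < u t := by
  obtain ⟨r, hr, hpos⟩ := mem_nhdsGT_iff_exists_Ioo_subset.1 hev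
  have hrb : r ≤ b := le_of_not_gt fun h ↦ absurd hb (not_le.2 (hpos ⟨hab, h⟩))
  obtain ⟨p, hap, hpr⟩ := exists_between (mem_Ioi.1 hr)
  have hp : 0 < u p := hpos ⟨hap, hpr⟩
  have hpb : p ≤ b := (hpr.trans_le hrb).le
  have hcp : ContinuousOn u (Icc p b) := hc.mono (Icc_subset_Icc_left hap.le)
  have hcpt : IsCompact (Icc p b ∩ u ⁻¹' Iic 0) :=
    isCompact_Icc.of_isClosed_subset (hcp.preimage_isClosed_of_isClosed isClosed_Icc isClosed_Iic)
      inter_subset_left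
  obtain ⟨t₀, ⟨ht₀, hut₀⟩, hleast⟩ := hcpt.exists_isLeast ⟨b, ⟨hpb, le_rfl⟩, hb⟩
  have hpost : ∀ t ∈ Ioo a t₀, 0 < u t := by
    intro t ht
    rcases le_or_gt p t with h | h
    · by_contra hcon
      exact absurd (hleast ⟨⟨h, ht.2.le.trans ht₀.2⟩, not_lt.1 hcon⟩) (not_le.2 ht.2)
    · exact hpos ⟨ht.1, h.trans hpr⟩
  refine ⟨t₀, ⟨hap.trans_le ht₀.1, ht₀.2⟩, ?_, hpost⟩
  obtain ⟨z, hz, hz0⟩ := intermediate_value_Icc' ht₀.1 (hcp.mono (Icc_subset_Icc_right ht₀.2))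
    ⟨hut₀, hp.le⟩
  have : t₀ ≤ z := hleast ⟨⟨hz.1, hz.2.trans ht₀.2⟩, hz0.le⟩
  rwa [le_antisymm hz.2 this] at hz0

theorem eventually_nhdsGT_pos_of_deriv_pos {r : ℝ} (h : HasDerivAt u r a) (h0 : u a = 0)
    (hr : 0 < r) : ∀ᶠ t in 𝓝[>] a, 0 < u t := by
  have h1 : Tendsto (slope u a) (𝓝[>] a) (𝓝 r) :=
    (hasDerivAt_iff_tendsto_slope.1 h).mono_left (nhdsWithin_mono _ fun x hx ↦ (ne_of_gt hx))
  filter_upwards [h1.eventually (lt_mem_nhds hr), self_mem_nhdsWithin] with t ht hta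
  rw [slope_def_field, h0, sub_zero] at ht
  exact (div_pos_iff_of_pos_right (sub_pos.2 hta)).1 ht

theorem deriv_nonneg_of_pos_right {r : ℝ} (hab : a < b) (h : HasDerivAt u r a) (h0 : u a = 0)
    (hpos : ∀ t ∈ Ioo a b, 0 < u t) : 0 ≤ r := by
  by_contra hr
  have h1 := eventually_nhdsGT_pos_of_deriv_pos h.neg (by simp [h0]) (by linarith)
  obtain ⟨t, h2, h3⟩ := (h1.and (Ioo_mem_nhdsGT hab)).exists
  simp only [Pi.neg_apply] at h2
  linarith [hpos t h3]

theorem deriv_nonpos_of_pos_left {r : ℝ} (hab : a < b) (h : HasDerivAt u r b) (h0 : u b = 0)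
    (hpos : ∀ t ∈ Ioo a b, 0 < u t) : r ≤ 0 := by
  have h1 : HasDerivAt (fun t ↦ u (-t)) (-r) (-b) :=
    ((neg_neg b).symm ▸ h : HasDerivAt u r (-(-b))).comp (-b) (hasDerivAt_neg (-b)) |>.congr_deriv
      (by simp)
  have h2 := deriv_nonneg_of_pos_right (neg_lt_neg hab) h1 (by simpa using h0)
    (fun t ht ↦ hpos _ ⟨by linarith [ht.2], by linarith [ht.1]⟩)
  linarith

end Calculus

/-! ### Solutions of `s'' ≥ 6 s²` and of its linearization -/

section Linearization

variable {s σ g d δ : ℝ → ℝ} {a b : ℝ}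

/-- A solution of the linearization of `s'' = 6 s²` that vanishes at a point where `s' > 0` and
increases there keeps increasing. The auxiliary function `G` is the derivative of the solution of
`s'' = 6 s²` with the same Cauchy data at `a`, expressed through `s`. -/
theorem deriv_pos_of_linearization (hs : ∀ t ∈ Icc a b, HasDerivAt s (σ t) t)
    (hσ : ∀ t ∈ Icc a b, HasDerivAt σ (g t) t) (hg : ∀ t ∈ Icc a b, 6 * s t ^ 2 ≤ g t)
    (hd : ∀ t ∈ Icc a b, HasDerivAt d (δ t) t)
    (hδ : ∀ t ∈ Icc a b, HasDerivAt δ (12 * s t * d t) t)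
    (hd0 : d a = 0) (hδ0 : 0 < δ a) (hσ0 : 0 < σ a) : ∀ t ∈ Icc a b, 0 < δ t := by
  by_contra! hcon
  obtain ⟨r, hr, hδr⟩ := hcon
  have har : a < r := hr.1.lt_of_ne fun h ↦ by rw [← h] at hδr; linarith
  have hsub : Icc a r ⊆ Icc a b := Icc_subset_Icc_right hr.2
  obtain ⟨t₀, ht₀, hδt₀, hpos⟩ := exists_first_zero har
    (fun t ht ↦ (hδ t (hsub ht)).continuousAt.continuousWithinAt)
    (((hδ a (left_mem_Icc.2 (hr.1.trans hr.2))).continuousAt.eventually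
      (lt_mem_nhds hδ0)).filter_mono nhdsWithin_le_nhds) hδr
  have hsub₀ : Icc a t₀ ⊆ Icc a b := Icc_subset_Icc_right (ht₀.2.trans hr.2)
  have hδnn : ∀ t ∈ Icc a t₀, 0 ≤ δ t := by
    intro t ht
    rcases ht.1.eq_or_lt with rfl | h1
    · exact hδ0.le
    rcases ht.2.eq_or_lt with rfl | h2
    · exact hδt₀.ge
    exact (hpos t ⟨h1, h2⟩).le
  have hdmono := monotoneOn_Icc_of_hasDerivAt_nonneg (fun t ht ↦ hd t (hsub₀ ht)) hδnn
  have ha₀ : a ∈ Icc a t₀ := left_mem_Icc.2 ht₀.1.le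
  have hdnn : ∀ t ∈ Icc a t₀, 0 ≤ d t := fun t ht ↦ hd0 ▸ hdmono ha₀ ht ht.1
  have hσmono := monotoneOn_Icc_of_hasDerivAt_nonneg (fun t ht ↦ hσ t (hsub₀ ht))
    (fun t ht ↦ (by positivity : (0:ℝ) ≤ 6 * s t ^ 2).trans (hg t (hsub₀ ht)))
  have hσpos : ∀ t ∈ Icc a t₀, 0 < σ t := fun t ht ↦ hσ0.trans_le (hσmono ha₀ ht ht.1)
  have hsmono := monotoneOn_Icc_of_hasDerivAt_nonneg (fun t ht ↦ hs t (hsub₀ ht))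
    (fun t ht ↦ (hσpos t ht).le)
  let G : ℝ → ℝ := fun t ↦ √(σ a ^ 2 - 4 * s a ^ 3 + 4 * s t ^ 3)
  have hrad : ∀ t ∈ Icc a t₀, 0 < σ a ^ 2 - 4 * s a ^ 3 + 4 * s t ^ 3 := by
    intro t ht
    have : s a ^ 3 ≤ s t ^ 3 := (Odd.strictMono_pow (by decide)).monotone (hsmono ha₀ ht ht.1)
    nlinarith [pow_pos hσ0 2]
  have hGpos : ∀ t ∈ Icc a t₀, 0 < G t := fun t ht ↦ Real.sqrt_pos.2 (hrad t ht)
  -- Since s'' ≥ 6s² and s' > 0, the first integral s'² - 4s³ of s'' = 6s² is nondecreasing along s.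
  have hGσ : ∀ t ∈ Icc a t₀, G t ≤ σ t := by
    intro t ht
    have hmono := monotoneOn_Icc_of_hasDerivAt_nonneg (u := fun t ↦ σ t ^ 2 - 4 * s t ^ 3)
      (v := fun t ↦ 2 * σ t * (g t - 6 * s t ^ 2)) (a := a) (b := t₀)
      (fun t ht ↦ (((hσ t (hsub₀ ht)).pow 2).sub
        (((hs t (hsub₀ ht)).pow 3).const_mul 4)).congr_deriv (by simp; ring))
      (fun t ht ↦ mul_nonneg (by linarith [hσpos t ht]) (sub_nonneg.2 (hg t (hsub₀ ht))))
    have := hmono ha₀ ht ht.1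
    simp only at this
    exact (Real.sqrt_le_sqrt (by linarith)).trans_eq (Real.sqrt_sq (hσpos t ht).le)
  have hG : ∀ t ∈ Icc a t₀, HasDerivAt G (6 * s t ^ 2 * σ t / G t) t := by
    intro t ht
    have h := ((((hs t (hsub₀ ht)).pow 3).const_mul 4).const_add
      (σ a ^ 2 - 4 * s a ^ 3)).sqrt (hrad t ht).ne'
    refine h.congr_deriv ?_
    have : √(σ a ^ 2 - 4 * s a ^ 3 + 4 * s t ^ 3) ≠ 0 := (hGpos t ht).ne'
    simp only [G, Pi.pow_apply]
    field_simp
    norm_num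
    ring
  have key : ∀ r ∈ Icc a t₀, s r ≤ 0 → 0 < δ r := by
    intro r hr hsr
    have hsub' : Icc a r ⊆ Icc a t₀ := Icc_subset_Icc_right hr.2
    -- If s solved s'' = 6s² exactly, then G = s' and this would be the constant Wronskian of s' and
    -- d. In general its derivative has the factor σ - G ≥ 0, and the other factor is nonnegative
    -- while s ≤ 0.
    have hV := monotoneOn_Icc_of_hasDerivAt_nonneg (u := fun t ↦ G t * δ t - 6 * s t ^ 2 * d t)
      (v := fun t ↦ (σ t - G t) * (6 * s t ^ 2 * δ t / G t - 12 * s t * d t)) (a := a) (b := r)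
      (fun t ht ↦ by
        have ht' := hsub' ht
        have h := ((hG t ht').mul (hδ t (hsub₀ ht'))).sub
          ((((hs t (hsub₀ ht')).pow 2).const_mul 6).mul (hd t (hsub₀ ht')))
        refine h.congr_deriv ?_
        have := (hGpos t ht').ne'
        simp only [Pi.pow_apply]
        field_simp
        norm_num
        ring)
      (fun t ht ↦ by
        have ht' := hsub' ht
        have hst : s t ≤ 0 := (hsmono ht' hr ht.2).trans hsr
        refine mul_nonneg (sub_nonneg.2 (hGσ t ht')) ?_
        have h1 : 0 ≤ 6 * s t ^ 2 * δ t / G t :=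
          div_nonneg (mul_nonneg (by positivity) (hδnn t ht')) (hGpos t ht').le
        have h2 : s t * d t ≤ 0 := mul_nonpos_of_nonpos_of_nonneg hst (hdnn t ht')
        nlinarith)
    have h := hV (left_mem_Icc.2 hr.1) (right_mem_Icc.2 hr.1) hr.1
    simp only [hd0, mul_zero, sub_zero] at h
    have h1 : 0 < G a * δ a := mul_pos (hGpos a ha₀) hδ0
    have h2 : 0 ≤ 6 * s r ^ 2 * d r := mul_nonneg (by positivity) (hdnn r hr)
    exact pos_of_mul_pos_right (by linarith : 0 < G r * δ r) (hGpos r hr).le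
  have key' : ∀ r ∈ Icc a t₀, 0 ≤ s r → δ r ≤ δ t₀ := by
    intro r hr hsr
    have hsub' : Icc r t₀ ⊆ Icc a t₀ := Icc_subset_Icc_left hr.1
    refine monotoneOn_Icc_of_hasDerivAt_nonneg (a := r) (b := t₀)
      (fun t ht ↦ hδ t (hsub₀ (hsub' ht)))
      (fun t ht ↦ mul_nonneg (mul_nonneg (by norm_num) ?_) (hdnn t (hsub' ht)))
      (left_mem_Icc.2 hr.2) (right_mem_Icc.2 hr.2) hr.2
    exact hsr.trans (hsmono hr (hsub' ht) ht.1)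
  have ht₀' : t₀ ∈ Icc a t₀ := right_mem_Icc.2 ht₀.1.le
  rcases le_total (s t₀) 0 with h | h
  · exact absurd (key t₀ ht₀' h) (by simp [hδt₀])
  rcases le_total 0 (s a) with h' | h'
  · linarith [key' a ha₀ h']
  -- Since s increases, the interval splits at a zero of s: `key` makes δ positive there, and
  -- afterwards δ' = 12sd ≥ 0 preserves this up to t₀.
  obtain ⟨z, hz, hsz⟩ := intermediate_value_Icc ht₀.1.le
    (fun t ht ↦ (hs t (hsub₀ ht)).continuousAt.continuousWithinAt) ⟨h', h⟩
  linarith [key z hz hsz.le, key' z hz hsz.ge]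

/-- At the second of two consecutive zeros of the difference `d` of two solutions, their mean `s`
is increasing. -/
theorem mean_deriv_pos_of_consecutive_zeros {c : ℝ} (hab : a < b) (ha : 0 ≤ a + c)
    (hs : ∀ t ∈ Icc a b, HasDerivAt s (σ t) t)
    (hσ : ∀ t ∈ Icc a b, HasDerivAt σ (6 * s t ^ 2 + 3 / 2 * d t ^ 2 + t + c) t)
    (hd : ∀ t ∈ Icc a b, HasDerivAt d (δ t) t)
    (hδ : ∀ t ∈ Icc a b, HasDerivAt δ (12 * s t * d t) t)
    (hda : d a = 0) (hdb : d b = 0) (hpos : ∀ t ∈ Ioo a b, 0 < d t) : 0 < σ b := by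
  by_contra! hσb
  have haI : a ∈ Icc a b := left_mem_Icc.2 hab.le
  have hbI : b ∈ Icc a b := right_mem_Icc.2 hab.le
  have hδa : 0 ≤ δ a := deriv_nonneg_of_pos_right hab (hd a haI) hda hpos
  have hδb : δ b ≤ 0 := deriv_nonpos_of_pos_left hab (hd b hbI) hdb hpos
  have hσa : σ a ≤ 0 := (monotoneOn_Icc_of_hasDerivAt_nonneg hσ
    (fun t ht ↦ by nlinarith [sq_nonneg (s t), sq_nonneg (d t), ht.1]) haI hbI hab.le).trans hσb
  -- This is s''d - s'd' - d³. Its derivative is exactly d, because s''' = 12ss' + 3dd' + 1. At the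
  -- endpoints only -s'd' remains, whose signs forbid an increase.
  have h := lt_of_hasDerivAt_pos (v := d) (u := fun t ↦
      (6 * s t ^ 2 + 3 / 2 * d t ^ 2 + t + c) * d t - σ t * δ t - d t ^ 3) hab
    (fun t ht ↦ by
      have h1 := ((((((hs t ht).pow 2).const_mul 6).add
        (((hd t ht).pow 2).const_mul (3 / 2))).add (hasDerivAt_id t)).add_const c).mul (hd t ht)
      refine ((h1.sub ((hσ t ht).mul (hδ t ht))).sub ((hd t ht).pow 3)).congr_deriv ?_
      simp
      ring) hpos
  simp only [hda, hdb] at h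
  nlinarith [mul_nonneg_of_nonpos_of_nonpos hσb hδb, mul_nonpos_of_nonpos_of_nonneg hσa hδa]

/-- The natural time scale at depth 1/h² is h: within time h half of the depth is climbed, the slope
then exceeds 1/(2h³), and convexity propagates that slope to b. -/
theorem lower_bound_of_slope_nonneg {h : ℝ} (hh : 0 < h) (hhab : 4 * h ≤ b - a)
    (hs : ∀ t ∈ Icc a b, HasDerivAt s (σ t) t) (hσ : ∀ t ∈ Icc a b, HasDerivAt σ (g t) t)
    (hg : ∀ t ∈ Icc a b, 6 * s t ^ 2 ≤ g t) (hσa : 0 ≤ σ a) (hsa : s a = -(1 / h ^ 2)) :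
    (b - a) / (4 * h ^ 3) ≤ s b := by
  have hσmono := monotoneOn_Icc_of_hasDerivAt_nonneg hσ
    (fun t ht ↦ (by positivity : (0:ℝ) ≤ 6 * s t ^ 2).trans (hg t ht))
  have hsub : Icc a (a + h) ⊆ Icc a b := Icc_subset_Icc_right (by linarith)
  have hh2 : 0 < 1 / h ^ 2 := by positivity
  -- Staying below half depth would give s'' ≥ (3/2)h⁻⁴, hence a gain of (3/4)h⁻² in time h, more
  -- than half of the depth.
  obtain ⟨r, hr, hsr⟩ : ∃ r ∈ Icc a (a + h), -(1 / h ^ 2) / 2 < s r := by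
    by_contra! hcon
    have h1 := quadratic_le (k := 3 / 2 * (1 / h ^ 2) ^ 2) (by linarith : a ≤ a + h)
      (fun t ht ↦ hs t (hsub ht)) (fun t ht ↦ hσ t (hsub ht))
      (fun t ht ↦ by nlinarith [hg t (hsub ht), hcon t ht])
    have h2 := hcon (a + h) ⟨by linarith, le_rfl⟩
    have h3 : 3 / 2 * (1 / h ^ 2) ^ 2 * (a + h - a) ^ 2 / 2 = 3 / 4 * (1 / h ^ 2) := by
      field_simp
      ring
    rw [h3, hsa] at h1
    nlinarith [mul_nonneg hσa hh.le]
  have har : a < r := hr.1.lt_of_ne fun he ↦ by rw [← he, hsa] at hsr; linarith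
  have hrb : r ≤ b := (hsub hr).2
  have hslope : 1 / h ^ 2 / 2 < σ r * h := by
    have h1 := tangent_right_le har.le (fun t ht ↦ hs t (Icc_subset_Icc_right hrb ht))
      (hσmono.mono (Icc_subset_Icc_right hrb))
    have h2 : 0 ≤ σ r := hσa.trans (hσmono (left_mem_Icc.2 (by linarith)) (hsub hr) hr.1)
    have h3 : σ r * (r - a) ≤ σ r * h := by gcongr; linarith [hr.2]
    linarith
  have h1 := tangent_left_le hrb (fun t ht ↦ hs t (Icc_subset_Icc_left hr.1 ht))
      (hσmono.mono (Icc_subset_Icc_left hr.1))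
  have h4 : 1 / (2 * h ^ 3) < σ r := by
    rw [div_lt_iff₀ (by positivity)]
    have : 1 / h ^ 2 / 2 * (2 * h ^ 2) = 1 := by field_simp
    nlinarith [mul_lt_mul_of_pos_right hslope (by positivity : 0 < 2 * h ^ 2)]
  have h5 : 1 / (2 * h ^ 3) * (3 / 4 * (b - a)) ≤ σ r * (b - r) :=
    mul_le_mul h4.le (by linarith [hr.2]) (by linarith) ((by positivity : 0 ≤ 1 / (2 * h ^ 3)).trans h4.le)
  have h6 : (1 / h ^ 2) / 2 ≤ 1 / (2 * h ^ 3) * (1 / 4 * (b - a)) := by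
    rw [show 1 / h ^ 2 / 2 = 1 / (2 * h ^ 3) * h by field_simp]
    gcongr
    linarith
  have h7 : (b - a) / (4 * h ^ 3) =
      1 / (2 * h ^ 3) * (3 / 4 * (b - a)) - 1 / (2 * h ^ 3) * (1 / 4 * (b - a)) := by
    field_simp
    ring
  linarith

/-- A priori lower bound for nondecreasing solutions of `s'' ≥ 6 s²` on intervals of length at
least `ℓ` that end below `K`. -/
theorem exists_lower_bound_of_slope_nonneg {ℓ : ℝ} (hℓ : 0 < ℓ) (K : ℝ) :
    ∃ C : ℝ, 0 < C ∧ ∀ (a b : ℝ) (s σ g : ℝ → ℝ), ℓ ≤ b - a →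
      (∀ t ∈ Icc a b, HasDerivAt s (σ t) t) → (∀ t ∈ Icc a b, HasDerivAt σ (g t) t) →
      (∀ t ∈ Icc a b, 6 * s t ^ 2 ≤ g t) → 0 ≤ σ a → s b ≤ K → -C ≤ s a := by
  -- For h < h₀ one has 4h³(|K| + 1) ≤ 4h(|K| + 1) < ℓ, so the bound (b - a)/(4h³) exceeds K.
  let h₀ := min 1 (ℓ / (4 * (|K| + 1)))
  have hK : 0 < 4 * (|K| + 1) := by positivity
  have hh₀ : 0 < h₀ := lt_min one_pos (by positivity)
  refine ⟨1 / h₀ ^ 2, by positivity, fun a b s σ g hab hs hσ hg hσa hsb ↦ ?_⟩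
  by_contra! hcon
  have hneg : 0 < -s a := by linarith [(by positivity : 0 < 1 / h₀ ^ 2)]
  let h := 1 / √(-s a)
  have hsq : 0 < √(-s a) := Real.sqrt_pos.2 hneg
  have hh : 0 < h := by positivity
  have hsa : s a = -(1 / h ^ 2) := by
    simp only [h]
    rw [div_pow, Real.sq_sqrt hneg.le]
    simp
  have hlt : h < h₀ := by
    rw [hsa, neg_lt_neg_iff] at hcon
    have := (one_div_lt_one_div (by positivity) (by positivity)).1 hcon
    exact lt_of_pow_lt_pow_left₀ 2 hh₀.le this
  have h1 : h < 1 := hlt.trans_le (min_le_left _ _)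
  have h2 : h * (4 * (|K| + 1)) < ℓ := (lt_div_iff₀ hK).1 (hlt.trans_le (min_le_right _ _))
  have h3 : 4 * h ≤ b - a := by nlinarith [abs_nonneg K]
  have h4 := lower_bound_of_slope_nonneg hh h3 hs hσ hg hσa hsa
  have h5 : h ^ 3 ≤ h := by nlinarith [mul_pos hh hh]
  have h6 : |K| + 1 ≤ (b - a) / (4 * h ^ 3) := by
    rw [le_div_iff₀ (by positivity)]
    nlinarith [abs_nonneg K]
  linarith [le_abs_self K]

end Linearization

/-! ### The shooting problem -/

/-- The maximal solutions of `u'' = 6 u² + t + c`, `u(0) = y₀`, `u'(0) = m`, indexed by the initial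
slope `m`; `D m` is the interval of existence and `v m` is the derivative of `u m`. -/
structure ShootingFamily (c y₀ : ℝ) where
  D : ℝ → Set ℝ
  u : ℝ → ℝ → ℝ
  v : ℝ → ℝ → ℝ
  c_nonneg : 0 ≤ c
  isOpen_D : ∀ m, IsOpen (D m)
  ordConnected_D : ∀ m, (D m).OrdConnected
  zero_mem : ∀ m, 0 ∈ D m
  u_zero : ∀ m, u m 0 = y₀
  v_zero : ∀ m, v m 0 = m
  hasDerivAt_u : ∀ m, ∀ t ∈ D m, HasDerivAt (u m) (v m t) t
  hasDerivAt_v : ∀ m, ∀ t ∈ D m, HasDerivAt (v m) (6 * u m t ^ 2 + t + c) t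
  mem_of_bounded : ∀ m T K, 0 < T → Ico 0 T ⊆ D m →
    (∀ t ∈ Ico 0 T, |u m t| ≤ K ∧ |v m t| ≤ K) → T ∈ D m

namespace ShootingFamily

variable {c y₀ : ℝ} (F : ShootingFamily c y₀) {m m₁ m₂ s t r T K b : ℝ}

theorem Icc_subset (ht : t ∈ F.D m) : Icc 0 t ⊆ F.D m :=
  (F.ordConnected_D m).out (F.zero_mem m) ht

theorem Icc_subset' (hr : 0 ≤ r) (ht : t ∈ F.D m) : Icc r t ⊆ F.D m :=
  (Icc_subset_Icc_left hr).trans (F.Icc_subset ht)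

theorem continuousOn_u (m : ℝ) : ContinuousOn (F.u m) (F.D m) :=
  fun t ht ↦ (F.hasDerivAt_u m t ht).continuousAt.continuousWithinAt

theorem monotoneOn_v (hr : 0 ≤ r) (ht : t ∈ F.D m) : MonotoneOn (F.v m) (Icc r t) :=
  monotoneOn_Icc_of_hasDerivAt_nonneg (fun _ hz ↦ F.hasDerivAt_v m _ (F.Icc_subset' hr ht hz))
    fun z hz ↦ by nlinarith [hz.1, F.c_nonneg, sq_nonneg (F.u m z)]

theorem tangent_left (hr : 0 ≤ r) (hrt : r ≤ t) (ht : t ∈ F.D m) :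
    F.u m r + F.v m r * (t - r) ≤ F.u m t :=
  tangent_left_le hrt (fun _ hz ↦ F.hasDerivAt_u m _ (F.Icc_subset' hr ht hz))
    (F.monotoneOn_v hr ht)

theorem tangent_right (hr : 0 ≤ r) (hrt : r ≤ t) (ht : t ∈ F.D m) :
    F.u m t ≤ F.u m r + F.v m t * (t - r) :=
  tangent_right_le hrt (fun _ hz ↦ F.hasDerivAt_u m _ (F.Icc_subset' hr ht hz))
    (F.monotoneOn_v hr ht)

theorem initial_tangent (h : 0 ≤ t) (ht : t ∈ F.D m) : y₀ + m * t ≤ F.u m t := by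
  simpa [F.u_zero, F.v_zero] using F.tangent_left le_rfl h ht

theorem chord (hr : 0 ≤ r) (hrs : r ≤ s) (hst : s ≤ t) (ht : t ∈ F.D m) :
    F.u m s * (t - r) ≤ F.u m r * (t - s) + F.u m t * (s - r) := by
  have h1 := F.tangent_left (hr.trans hrs) hst ht
  have h2 := F.tangent_right hr hrs (F.Icc_subset ht ⟨hr.trans hrs, hst⟩)
  nlinarith [mul_le_mul_of_nonneg_right h1 (sub_nonneg.2 hrs),
    mul_le_mul_of_nonneg_right h2 (sub_nonneg.2 hst)]

theorem le_max (hs : 0 ≤ s) (hst : s ≤ t) (ht : t ∈ F.D m) : F.u m s ≤ max y₀ (F.u m t) := by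
  rcases hs.eq_or_lt with rfl | hs0
  · rw [F.u_zero]; exact le_max_left _ _
  have h := F.chord le_rfl hs hst ht
  rw [F.u_zero] at h
  have h1 := mul_le_mul_of_nonneg_right (le_max_left y₀ (F.u m t)) (sub_nonneg.2 hst)
  have h2 := mul_le_mul_of_nonneg_right (le_max_right y₀ (F.u m t)) hs
  nlinarith

/-- By convexity, a solution that has risen above its initial value has positive slope there and
keeps rising. -/
theorem le_of_initial_lt (hs : 0 ≤ s) (hst : s ≤ t) (ht : t ∈ F.D m) (h : y₀ < F.u m s) :
    F.u m s ≤ F.u m t := by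
  have h1 := F.tangent_right le_rfl hs (F.Icc_subset ht ⟨hs, hst⟩)
  have h2 := F.tangent_left hs hst ht
  rw [F.u_zero] at h1
  have h3 : 0 < F.v m s := by
    by_contra hcon
    nlinarith
  nlinarith

theorem mem_of_bounded_u (hT : 0 < T) (hD : Ico 0 T ⊆ F.D m)
    (hK : ∀ t ∈ Ico 0 T, |F.u m t| ≤ K) : T ∈ F.D m := by
  have hK0 : 0 ≤ K := (abs_nonneg _).trans (hK 0 ⟨le_rfl, hT⟩)
  refine F.mem_of_bounded m T (max K (|m| + (6 * K ^ 2 + T + c) * T)) hT hD fun t ht ↦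
    ⟨(hK t ht).trans (le_max_left _ _), (abs_le.2 ⟨?_, ?_⟩).trans (le_max_right _ _)⟩
  all_goals
    have hB : 0 ≤ 6 * K ^ 2 + T + c := by nlinarith [F.c_nonneg, sq_nonneg K]
  · have h := F.monotoneOn_v le_rfl (hD ht) (left_mem_Icc.2 ht.1) (right_mem_Icc.2 ht.1) ht.1
    rw [F.v_zero] at h
    nlinarith [neg_abs_le m]
  · have h := le_add_mul_sub (k := 6 * K ^ 2 + T + c) ht.1
      (fun z hz ↦ F.hasDerivAt_v m z (F.Icc_subset (hD ht) hz)) (fun z hz ↦ by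
        have h1 := sq_le_sq' (abs_le.1 (hK z ⟨hz.1, hz.2.trans_lt ht.2⟩)).1
          (abs_le.1 (hK z ⟨hz.1, hz.2.trans_lt ht.2⟩)).2
        linarith [hz.2, ht.2])
    rw [F.v_zero] at h
    nlinarith [le_abs_self m, ht.2]

/-- Convexity keeps u above its tangent at 0, so blow-up in finite time can only be upwards. -/
theorem mem_of_bddAbove (hT : 0 ≤ T) (hK : ∀ t ∈ Icc 0 T, t ∈ F.D m → F.u m t ≤ K) :
    T ∈ F.D m := by
  by_contra hTD
  have hcpt : IsCompact (Icc 0 T ∩ (F.D m)ᶜ) :=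
    isCompact_Icc.inter_right (F.isOpen_D m).isClosed_compl
  obtain ⟨t₀, ⟨ht₀, ht₀D⟩, hleast⟩ := hcpt.exists_isLeast ⟨T, ⟨hT, le_rfl⟩, hTD⟩
  have hpos : 0 < t₀ := ht₀.1.lt_of_ne fun h ↦ ht₀D (h ▸ F.zero_mem m)
  have hD : Ico 0 t₀ ⊆ F.D m := fun t ht ↦ by
    by_contra h
    exact absurd (hleast ⟨⟨ht.1, ht.2.le.trans ht₀.2⟩, h⟩) (not_le.2 ht.2)
  refine ht₀D (F.mem_of_bounded_u (K := |K| + |y₀| + |m| * T) hpos hD fun t ht ↦ abs_le.2 ⟨?_, ?_⟩)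
  · have h1 := F.initial_tangent ht.1 (hD ht)
    have h2 : |m * t| ≤ |m| * T := by
      rw [abs_mul, abs_of_nonneg ht.1]
      exact mul_le_mul_of_nonneg_left (ht.2.le.trans ht₀.2) (abs_nonneg m)
    linarith [neg_abs_le y₀, (abs_le.1 h2).1, abs_nonneg K]
  · have h1 := hK t ⟨ht.1, ht.2.le.trans ht₀.2⟩ (hD ht)
    have h2 : 0 ≤ |m| * T := mul_nonneg (abs_nonneg _) hT
    linarith [le_abs_self K, abs_nonneg y₀]

/-! ### Differences of two solutions -/

theorem hasDerivAt_u_sub (h₁ : t ∈ F.D m₁) (h₂ : t ∈ F.D m₂) :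
    HasDerivAt (fun t ↦ F.u m₁ t - F.u m₂ t) (F.v m₁ t - F.v m₂ t) t :=
  (F.hasDerivAt_u m₁ t h₁).sub (F.hasDerivAt_u m₂ t h₂)

theorem hasDerivAt_v_sub (h₁ : t ∈ F.D m₁) (h₂ : t ∈ F.D m₂) :
    HasDerivAt (fun t ↦ F.v m₁ t - F.v m₂ t)
      (12 * ((F.u m₁ t + F.u m₂ t) / 2) * (F.u m₁ t - F.u m₂ t)) t :=
  ((F.hasDerivAt_v m₁ t h₁).sub (F.hasDerivAt_v m₂ t h₂)).congr_deriv (by ring)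

theorem hasDerivAt_u_mean (h₁ : t ∈ F.D m₁) (h₂ : t ∈ F.D m₂) :
    HasDerivAt (fun t ↦ (F.u m₁ t + F.u m₂ t) / 2) ((F.v m₁ t + F.v m₂ t) / 2) t :=
  ((F.hasDerivAt_u m₁ t h₁).add (F.hasDerivAt_u m₂ t h₂)).div_const 2

theorem hasDerivAt_v_mean (h₁ : t ∈ F.D m₁) (h₂ : t ∈ F.D m₂) :
    HasDerivAt (fun t ↦ (F.v m₁ t + F.v m₂ t) / 2)
      (6 * ((F.u m₁ t + F.u m₂ t) / 2) ^ 2 + 3 / 2 * (F.u m₁ t - F.u m₂ t) ^ 2 + t + c) t :=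
  (((F.hasDerivAt_v m₁ t h₁).add (F.hasDerivAt_v m₂ t h₂)).div_const 2).congr_deriv (by ring)

theorem eventually_lt (hm : m₂ < m₁) : ∀ᶠ t in 𝓝[>] 0, 0 < F.u m₁ t - F.u m₂ t :=
  eventually_nhdsGT_pos_of_deriv_pos (F.hasDerivAt_u_sub (F.zero_mem m₁) (F.zero_mem m₂))
    (by simp [F.u_zero]) (by simpa [F.v_zero] using hm)

theorem exists_mean_bound (h₁ : t ∈ F.D m₁) (h₂ : t ∈ F.D m₂) :
    ∃ C, ∀ z ∈ Icc 0 t, |12 * ((F.u m₁ z + F.u m₂ z) / 2)| ≤ C := by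
  refine isCompact_Icc.exists_bound_of_continuousOn (f := fun z ↦ 12 * ((F.u m₁ z + F.u m₂ z) / 2))
    fun z hz ↦ ?_
  exact ((F.hasDerivAt_u_mean (F.Icc_subset h₁ hz)
    (F.Icc_subset h₂ hz)).continuousAt.const_mul 12).continuousWithinAt

/-- Two solutions with different initial slopes meet at most once after `0`: if the steeper one is
not above the other at `t`, then it is above it up to a first meeting and below it afterwards. -/
theorem exists_first_meeting (hm : m₂ < m₁) (h₁ : T ∈ F.D m₁) (h₂ : T ∈ F.D m₂) (ht : 0 < t)
    (htT : t ≤ T) (hle : F.u m₁ t ≤ F.u m₂ t) :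
    ∃ t₀ ∈ Ioc 0 t, F.u m₁ t₀ = F.u m₂ t₀ ∧ (∀ r ∈ Ioo 0 t₀, F.u m₂ r < F.u m₁ r) ∧
      ∀ r ∈ Ioc t₀ T, F.u m₁ r < F.u m₂ r := by
  have hT : Icc 0 t ⊆ Icc 0 T := Icc_subset_Icc_right htT
  obtain ⟨t₀, ht₀, hz, hpos⟩ := exists_first_zero ht
    (fun z hz ↦ (F.hasDerivAt_u_sub (F.Icc_subset h₁ (hT hz))
      (F.Icc_subset h₂ (hT hz))).continuousAt.continuousWithinAt)
    (F.eventually_lt hm) (sub_nonpos.2 hle)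
  refine ⟨t₀, ht₀, sub_eq_zero.1 hz, fun r hr ↦ sub_pos.1 (hpos r hr), fun r hr ↦ ?_⟩
  have htT₀ : t₀ ≤ T := ht₀.2.trans htT
  have h₁₀ : t₀ ∈ F.D m₁ := F.Icc_subset h₁ ⟨ht₀.1.le, htT₀⟩
  have h₂₀ : t₀ ∈ F.D m₂ := F.Icc_subset h₂ ⟨ht₀.1.le, htT₀⟩
  have i₁ := fun z (hz : z ∈ Icc 0 t₀) ↦ F.Icc_subset h₁₀ hz
  have i₂ := fun z (hz : z ∈ Icc 0 t₀) ↦ F.Icc_subset h₂₀ hz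
  have j₁ := fun z (hz : z ∈ Icc t₀ T) ↦ F.Icc_subset' ht₀.1.le h₁ hz
  have j₂ := fun z (hz : z ∈ Icc t₀ T) ↦ F.Icc_subset' ht₀.1.le h₂ hz
  obtain ⟨C, hC⟩ := F.exists_mean_bound h₁₀ h₂₀
  -- A tangential meeting would give equal Cauchy data at t₀, hence at 0, against `m₂ < m₁`.
  have hδ : F.v m₁ t₀ - F.v m₂ t₀ < 0 := by
    refine lt_of_le_of_ne (deriv_nonpos_of_pos_left ht₀.1 (F.hasDerivAt_u_sub h₁₀ h₂₀) hz hpos)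
      fun h0 ↦ ?_
    have := ((cauchyData_eq_zero_iff ht₀.1.le
      (fun z hz ↦ F.hasDerivAt_u_sub (i₁ z hz) (i₂ z hz))
      (fun z hz ↦ F.hasDerivAt_v_sub (i₁ z hz) (i₂ z hz)) hC).2 ⟨hz, h0⟩).2
    simp only [F.v_zero] at this
    linarith
  have hσ : 0 < (F.v m₁ t₀ + F.v m₂ t₀) / 2 :=
    mean_deriv_pos_of_consecutive_zeros (a := 0) (c := c)
      (σ := fun t ↦ (F.v m₁ t + F.v m₂ t) / 2) ht₀.1 (by simpa using F.c_nonneg)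
      (fun z hz ↦ F.hasDerivAt_u_mean (i₁ z hz) (i₂ z hz))
      (fun z hz ↦ F.hasDerivAt_v_mean (i₁ z hz) (i₂ z hz))
      (fun z hz ↦ F.hasDerivAt_u_sub (i₁ z hz) (i₂ z hz))
      (fun z hz ↦ F.hasDerivAt_v_sub (i₁ z hz) (i₂ z hz)) (by simp [F.u_zero]) hz hpos
  have hinc := deriv_pos_of_linearization (a := t₀) (b := T)
    (σ := fun t ↦ (F.v m₁ t + F.v m₂ t) / 2)
    (fun z hz ↦ F.hasDerivAt_u_mean (j₁ z hz) (j₂ z hz))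
    (fun z hz ↦ F.hasDerivAt_v_mean (j₁ z hz) (j₂ z hz))
    (fun z hz ↦ by nlinarith [hz.1, ht₀.1, F.c_nonneg, sq_nonneg (F.u m₁ z - F.u m₂ z)])
    (fun z hz ↦ (F.hasDerivAt_u_sub (j₁ z hz) (j₂ z hz)).neg)
    (fun z hz ↦ (F.hasDerivAt_v_sub (j₁ z hz) (j₂ z hz)).neg.congr_deriv (by simp; ring))
    (by simp only [Pi.neg_apply, hz, neg_zero]) (by simpa using hδ) hσ
  have hlt := lt_of_hasDerivAt_pos hr.1
    (fun z hz ↦ (F.hasDerivAt_u_sub (j₁ z ⟨hz.1, hz.2.trans hr.2⟩)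
      (j₂ z ⟨hz.1, hz.2.trans hr.2⟩)).neg)
    (fun z hz ↦ hinc z ⟨hz.1.le, hz.2.le.trans hr.2⟩)
  simp only [Pi.neg_apply, hz] at hlt
  linarith

theorem lt_of_eq_at (hm : m₂ < m₁) (h₁ : T ∈ F.D m₁) (h₂ : T ∈ F.D m₂)
    (heq : F.u m₁ T = F.u m₂ T) : ∀ t ∈ Ioo 0 T, F.u m₂ t < F.u m₁ t := by
  intro t ht
  by_contra! hle
  obtain ⟨t₀, ht₀, -, -, h⟩ := F.exists_first_meeting hm h₁ h₂ ht.1 ht.2.le hle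
  exact absurd heq (h T ⟨ht₀.2.trans_lt ht.2, le_rfl⟩).ne

/-- Of three solutions ordered by their slopes, the two upper ones cannot be the first to meet. -/
theorem ne_of_ordered (hT : 0 < T) (h₁ : T ∈ F.D m₁) (h : T ∈ F.D m) (h₂ : T ∈ F.D m₂)
    (hlt₁ : ∀ t ∈ Ioo 0 T, F.u m t < F.u m₁ t) (hlt₂ : ∀ t ∈ Ioo 0 T, F.u m₂ t < F.u m t)
    (hle : F.u m₂ T ≤ F.u m T) : F.u m T ≠ F.u m₁ T := by
  intro heq
  -- The Wronskian of the two successive differences vanishes at 0, and its derivative is six times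
  -- the product of the three pairwise differences. A meeting of the upper two at T would make it
  -- nonpositive there.
  have hW := lt_of_hasDerivAt_pos hT (u := fun t ↦
      (F.u m t - F.u m₂ t) * (F.v m₁ t - F.v m t) - (F.v m t - F.v m₂ t) * (F.u m₁ t - F.u m t))
    (v := fun t ↦ 6 * (F.u m₁ t - F.u m₂ t) * (F.u m t - F.u m₂ t) * (F.u m₁ t - F.u m t))
    (fun t ht ↦ by
      have i₁ := F.Icc_subset h₁ ht
      have i := F.Icc_subset h ht
      have i₂ := F.Icc_subset h₂ ht
      refine (((F.hasDerivAt_u_sub i i₂).mul (F.hasDerivAt_v_sub i₁ i)).sub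
        ((F.hasDerivAt_v_sub i i₂).mul (F.hasDerivAt_u_sub i₁ i))).congr_deriv ?_
      ring)
    (fun t ht ↦ by
      have a := sub_pos.2 (hlt₁ t ht)
      have b := sub_pos.2 (hlt₂ t ht)
      have d : 0 < F.u m₁ t - F.u m₂ t := by linarith
      positivity)
  have hδ : F.v m₁ T - F.v m T ≤ 0 := deriv_nonpos_of_pos_left hT (F.hasDerivAt_u_sub h₁ h)
    (by simp [heq]) (fun t ht ↦ sub_pos.2 (hlt₁ t ht))
  simp only [F.u_zero, heq, sub_self, zero_mul, mul_zero] at hW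
  rw [heq] at hle
  nlinarith [mul_nonneg_of_nonpos_of_nonpos hδ (sub_nonpos.2 hle)]

/-- Between two solutions of the same Dirichlet problem, all solutions lie below the boundary
value. -/
theorem lt_of_between (hT : 0 < T) (hm₂ : m₂ < m) (hm₁ : m < m₁) (h₁ : T ∈ F.D m₁)
    (h₂ : T ∈ F.D m₂) (heq : F.u m₁ T = F.u m₂ T) : T ∈ F.D m ∧ F.u m T < F.u m₁ T := by
  obtain ⟨K, hK⟩ := isCompact_Icc.exists_bound_of_continuousOn
    ((F.continuousOn_u m₁).mono (F.Icc_subset h₁))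
  have h₁₂ := F.lt_of_eq_at (hm₂.trans hm₁) h₁ h₂ heq
  have h₁₂' : ∀ t ∈ Ioc 0 T, F.u m₂ t ≤ F.u m₁ t := by
    intro t ht
    rcases ht.2.eq_or_lt with rfl | hlt
    · exact heq.ge
    · exact (h₁₂ t ⟨ht.1, hlt⟩).le
  -- Otherwise `u m` stays above `u m₂`, cannot meet `u m₁` before T by `ne_of_ordered`, and is
  -- squeezed so that it meets `u m₁` at T, which `ne_of_ordered` excludes too.
  obtain ⟨t₁, ht₁, ht₁D, hle⟩ : ∃ t ∈ Ioo 0 T, t ∈ F.D m ∧ F.u m t ≤ F.u m₂ t := by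
    by_contra! hcon
    have hup : ∀ t ∈ Ioo 0 T, t ∈ F.D m → F.u m t < F.u m₁ t := by
      intro t ht htD
      by_contra! hle
      have htD₁ := F.Icc_subset h₁ ⟨ht.1.le, ht.2.le⟩
      obtain ⟨t₀, ht₀, he, hlt, -⟩ := F.exists_first_meeting hm₁ htD₁ htD ht.1 le_rfl hle
      have hm₀ : t₀ ∈ Icc 0 T := ⟨ht₀.1.le, ht₀.2.trans ht.2.le⟩
      have htD₀ := F.Icc_subset htD ⟨ht₀.1.le, ht₀.2⟩
      refine F.ne_of_ordered ht₀.1 (F.Icc_subset h₁ hm₀) htD₀ (F.Icc_subset h₂ hm₀) hlt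
        (fun r hr ↦ hcon r ⟨hr.1, hr.2.trans_le hm₀.2⟩ (F.Icc_subset htD₀ ⟨hr.1.le, hr.2.le⟩))
        (hcon t₀ ⟨ht₀.1, ht₀.2.trans_lt ht.2⟩ htD₀).le he.symm
    have hIco : ∀ t ∈ Ico 0 T, t ∈ F.D m := by
      intro t ht
      refine F.mem_of_bddAbove ht.1 (K := K) fun z hz hzD ↦ ?_
      have hb := (abs_le.1 (hK z ⟨hz.1, hz.2.trans ht.2.le⟩)).2
      rcases hz.1.eq_or_lt with rfl | hz0
      · rwa [F.u_zero, ← F.u_zero m₁]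
      · exact (hup z ⟨hz0, hz.2.trans_lt ht.2⟩ hzD).le.trans hb
    have hTD : T ∈ F.D m := by
      refine F.mem_of_bounded_u (K := K + |y₀| + |m| * T) hT hIco fun t ht ↦ abs_le.2 ⟨?_, ?_⟩
      · have h1 := F.initial_tangent ht.1 (hIco t ht)
        have h2 : |m * t| ≤ |m| * T := by
          rw [abs_mul, abs_of_nonneg ht.1]
          exact mul_le_mul_of_nonneg_left ht.2.le (abs_nonneg m)
        linarith [neg_abs_le y₀, (abs_le.1 h2).1,
          (abs_nonneg _).trans (hK 0 (left_mem_Icc.2 hT.le))]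
      · have hb := (abs_le.1 (hK t ⟨ht.1, ht.2.le⟩)).2
        have h2 : 0 ≤ |m| * T := mul_nonneg (abs_nonneg _) hT.le
        rcases ht.1.eq_or_lt with rfl | ht0
        · rw [F.u_zero] at hb ⊢
          linarith [abs_nonneg y₀]
        · linarith [hup t ⟨ht0, ht.2⟩ (hIco t ht), abs_nonneg y₀]
    have hup' : ∀ t ∈ Ioo 0 T, F.u m t < F.u m₁ t :=
      fun t ht ↦ hup t ht (hIco t ⟨ht.1.le, ht.2⟩)
    have hlow' : ∀ t ∈ Ioo 0 T, F.u m₂ t < F.u m t :=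
      fun t ht ↦ hcon t ht (hIco t ⟨ht.1.le, ht.2⟩)
    have hclos : T ∈ closure (Ioo 0 T) := by
      rw [closure_Ioo hT.ne]
      exact right_mem_Icc.2 hT.le
    have hc : ∀ {m}, T ∈ F.D m → ContinuousWithinAt (F.u m) (Ioo 0 T) T :=
      fun h ↦ (F.hasDerivAt_u _ T h).continuousAt.continuousWithinAt
    have hle₁ := ContinuousWithinAt.closure_le hclos (hc hTD) (hc h₁) fun t ht ↦ (hup' t ht).le
    have hle₂ := ContinuousWithinAt.closure_le hclos (hc h₂) (hc hTD) fun t ht ↦ (hlow' t ht).le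
    exact F.ne_of_ordered hT h₁ hTD h₂ hup' hlow' hle₂ (le_antisymm hle₁ (heq ▸ hle₂))
  have hafter : ∀ t ∈ Ioc t₁ T, t ∈ F.D m → F.u m t < F.u m₂ t := by
    intro t ht htD
    have htD₂ := F.Icc_subset h₂ ⟨(ht₁.1.trans ht.1).le, ht.2⟩
    obtain ⟨t₀, ht₀, -, -, h⟩ := F.exists_first_meeting hm₂ htD htD₂ ht₁.1 ht.1.le hle
    exact h t ⟨ht₀.2.trans_lt ht.1, le_rfl⟩
  obtain ⟨K', hK'⟩ := isCompact_Icc.exists_bound_of_continuousOn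
    ((F.continuousOn_u m).mono (F.Icc_subset ht₁D))
  have hTD : T ∈ F.D m := by
    refine F.mem_of_bddAbove hT.le (K := max K K') fun t ht htD ↦ ?_
    rcases le_or_gt t t₁ with h | h
    · exact ((le_abs_self _).trans (hK' t ⟨ht.1, h⟩)).trans (le_max_right _ _)
    · exact (((hafter t ⟨h, ht.2⟩ htD).le.trans (h₁₂' t ⟨ht₁.1.trans h, ht.2⟩)).trans
        ((le_abs_self _).trans (hK t ht))).trans (le_max_left _ _)
  exact ⟨hTD, heq ▸ hafter T ⟨ht₁.2, le_rfl⟩ hTD⟩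

end ShootingFamily

namespace ShootingFamily

variable {c y₀ : ℝ} (F : ShootingFamily c y₀) {m m₁ m₂ s t r T T₁ T₂ K L b ε : ℝ}

/-! ### A priori bounds -/

/-- At T/2 the solution is nondecreasing towards T or, with time reversed, towards 0; great depth
there would force too large a value at that end. Convexity carries the bound from T/2 to all of [0,
T]. -/
theorem exists_lower_bound (hT₁ : 0 < T₁) (b : ℝ) :
    ∃ C, 0 ≤ C ∧ ∀ T m, T₁ ≤ T → T ∈ F.D m → F.u m T ≤ b → ∀ t ∈ Icc 0 T, -C ≤ F.u m t := by
  obtain ⟨C, hC, H⟩ := exists_lower_bound_of_slope_nonneg (half_pos hT₁) (|y₀| + |b|)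
  refine ⟨2 * C + (|y₀| + |b|), by positivity, fun T m hT hTD hb t ht ↦ ?_⟩
  have hT0 : 0 < T := hT₁.trans_le hT
  have hI : ∀ {z}, z ∈ Icc 0 T → z ∈ F.D m := fun hz ↦ F.Icc_subset hTD hz
  have hg : ∀ z ∈ Icc 0 T, 6 * F.u m z ^ 2 ≤ 6 * F.u m z ^ 2 + z + c :=
    fun z hz ↦ by linarith [hz.1, F.c_nonneg]
  have hmid : -C ≤ F.u m (T / 2) := by
    rcases le_total 0 (F.v m (T / 2)) with hv | hv
    · have hsub : Icc (T / 2) T ⊆ Icc 0 T := Icc_subset_Icc_left (by linarith)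
      exact H (T / 2) T (F.u m) (F.v m) _ (by linarith)
        (fun z hz ↦ F.hasDerivAt_u m z (hI (hsub hz)))
        (fun z hz ↦ F.hasDerivAt_v m z (hI (hsub hz))) (fun z hz ↦ hg z (hsub hz)) hv
        (by linarith [le_abs_self b, abs_nonneg y₀])
    · have hsub : Icc 0 (T / 2) ⊆ Icc 0 T := Icc_subset_Icc_right (by linarith)
      have h := H (-(T / 2)) (-0) (fun z ↦ F.u m (-z)) (fun z ↦ -F.v m (-z)) _ (by linarith)
        (hasDerivAt_comp_neg_of_forall fun z hz ↦ F.hasDerivAt_u m z (hI (hsub hz)))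
        (hasDerivAt_neg_comp_neg_of_forall fun z hz ↦ F.hasDerivAt_v m z (hI (hsub hz)))
        (fun z hz ↦ hg (-z) (hsub ⟨by linarith [hz.2], by linarith [hz.1]⟩))
        (by simpa using hv)
        (by simp only [neg_zero, F.u_zero]; linarith [le_abs_self y₀, abs_nonneg b])
      simpa using h
  have hy := le_abs_self y₀
  have hb' := le_abs_self b
  have hb0 := abs_nonneg b
  have hy0 := abs_nonneg y₀
  rcases le_total t (T / 2) with h | h
  · have h1 := F.chord ht.1 h (by linarith) hTD
    have h2 : F.u m T * (T / 2 - t) ≤ (|y₀| + |b|) * (T / 2) := by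
      apply mul_le_mul <;> linarith [ht.1]
    have h3 : -C * T ≤ F.u m (T / 2) * (T - t) := by nlinarith [ht.1, ht.2]
    by_contra! hcon
    nlinarith
  · have h1 := F.chord le_rfl (by linarith : 0 ≤ T / 2) h (hI ht)
    rw [F.u_zero] at h1
    have h2 : y₀ * (t - T / 2) ≤ (|y₀| + |b|) * (T / 2) := by
      apply mul_le_mul <;> linarith [ht.2]
    have h3 : -C * T ≤ F.u m (T / 2) * (t - 0) := by nlinarith [ht.1, ht.2]
    by_contra! hcon
    nlinarith

theorem le_initial_add (ht : 0 ≤ t) (htT : t ≤ T) (htD : t ∈ F.D m)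
    (hK : ∀ z ∈ Icc 0 t, |F.u m z| ≤ K) :
    F.u m t ≤ y₀ + (m + (6 * K ^ 2 + T + c) * T) * t := by
  have h := le_quadratic (k := 6 * K ^ 2 + T + c) ht
    (fun z hz ↦ F.hasDerivAt_u m z (F.Icc_subset htD hz))
    (fun z hz ↦ F.hasDerivAt_v m z (F.Icc_subset htD hz)) (fun z hz ↦ by
      have h1 := sq_le_sq' (abs_le.1 (hK z hz)).1 (abs_le.1 (hK z hz)).2
      linarith [hz.2])
  rw [F.u_zero, F.v_zero] at h
  have hB : 0 ≤ 6 * K ^ 2 + T + c := by nlinarith [F.c_nonneg, sq_nonneg K]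
  nlinarith [mul_nonneg hB ht, mul_le_mul_of_nonneg_left htT (mul_nonneg hB ht),
    mul_nonneg (mul_nonneg hB ht) ht]

/-- The lower bound and convexity confine u to [-K, K]. Then a very negative m would take u(T) below
the lower bound, and a large m would lift the initial tangent above b. -/
theorem exists_slope_bound (hT₁ : 0 < T₁) (T₂ b : ℝ) :
    ∃ N, 0 ≤ N ∧ ∀ T m, T₁ ≤ T → T ≤ T₂ → T ∈ F.D m → F.u m T ≤ b → |m| ≤ N := by
  obtain ⟨C, hC, H⟩ := F.exists_lower_bound hT₁ b
  let K := C + |y₀| + |b|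
  have hK0 : 0 ≤ K := by positivity
  refine ⟨K / T₁ + |(6 * K ^ 2 + T₂ + c) * T₂|, by positivity, fun T m hT hT' hTD hb ↦ ?_⟩
  have hT0 : 0 < T := hT₁.trans_le hT
  have hlow := H T m hT hTD hb
  have hKT : K / T ≤ K / T₁ := div_le_div_of_nonneg_left hK0 hT₁ hT
  have hKb : ∀ z ∈ Icc 0 T, |F.u m z| ≤ K := by
    intro z hz
    refine abs_le.2 ⟨?_, ?_⟩
    · have := hlow z hz
      simp only [K]
      linarith [abs_nonneg y₀, abs_nonneg b]
    · have := F.le_max hz.1 hz.2 hTD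
      have h2 : max y₀ (F.u m T) ≤ K := max_le
        (by simp only [K]; linarith [le_abs_self y₀, abs_nonneg b])
        (by simp only [K]; linarith [le_abs_self b, abs_nonneg y₀])
      exact this.trans h2
  refine abs_le.2 ⟨?_, ?_⟩
  · have h1 := F.le_initial_add hT0.le hT' hTD hKb
    have h2 := hlow T (right_mem_Icc.2 hT0.le)
    have h3 : -(m + (6 * K ^ 2 + T₂ + c) * T₂) ≤ K / T := by
      rw [le_div_iff₀ hT0]
      have : C + y₀ ≤ K := by simp only [K]; linarith [le_abs_self y₀, abs_nonneg b]
      linarith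
    linarith [le_abs_self ((6 * K ^ 2 + T₂ + c) * T₂)]
  · have h1 := F.initial_tangent hT0.le hTD
    have h3 : m ≤ K / T := by
      rw [le_div_iff₀ hT0]
      have : b - y₀ ≤ K := by simp only [K]; linarith [le_abs_self b, neg_abs_le y₀]
      linarith
    linarith [abs_nonneg ((6 * K ^ 2 + T₂ + c) * T₂)]

/-- The slope bound at time 1 controls the data there from below; from then on u'' ≥ 1, so u grows
quadratically past b. -/
theorem exists_time_bound (b : ℝ) :
    ∃ T₂, ∀ T m, 0 ≤ T → T ∈ F.D m → F.u m T ≤ b → T ≤ T₂ := by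
  obtain ⟨N, hN, H⟩ := F.exists_slope_bound one_pos 1 (max y₀ b)
  let Q := |b - y₀| + N
  have hQ : 0 ≤ Q := by positivity
  refine ⟨1 + (2 * N + 2 * Q + 1), fun T m hT hTD hb ↦ ?_⟩
  by_contra! hcon
  have hT1 : 1 ≤ T := by linarith
  have h1D : 1 ∈ F.D m := F.Icc_subset hTD ⟨zero_le_one, hT1⟩
  have hm := abs_le.1 (H 1 m le_rfl le_rfl h1D
    ((F.le_max zero_le_one hT1 hTD).trans (max_le_max le_rfl hb)))
  have hu1 := F.initial_tangent zero_le_one h1D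
  have hv1 := F.monotoneOn_v le_rfl h1D (left_mem_Icc.2 zero_le_one)
    (right_mem_Icc.2 zero_le_one) zero_le_one
  rw [F.v_zero] at hv1
  have h := quadratic_le (k := 1) hT1
    (fun z hz ↦ F.hasDerivAt_u m z (F.Icc_subset' zero_le_one hTD hz))
    (fun z hz ↦ F.hasDerivAt_v m z (F.Icc_subset' zero_le_one hTD hz))
    (fun z hz ↦ by nlinarith [hz.1, F.c_nonneg, sq_nonneg (F.u m z)])
  have h2 : -N * (T - 1) ≤ F.v m 1 * (T - 1) := by
    apply mul_le_mul_of_nonneg_right <;> linarith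
  have h3 : (T - 1) ^ 2 ≤ 2 * N * (T - 1) + 2 * Q := by
    have := le_abs_self (b - y₀)
    simp only [Q]
    linarith
  nlinarith

/-- Steep solutions get arbitrarily low in arbitrarily short time. -/
theorem exists_lt (hT : 0 < T) (L : ℝ) : ∃ m, ∃ t ∈ Icc 0 T, t ∈ F.D m ∧ F.u m t < L := by
  by_contra! hcon
  let K := |y₀| + |L|
  -- With this slope, as long as u stays between L and y₀, `le_initial_add` gives u(t) ≤ y₀ - (K +
  -- 1)t/T: no return to y₀, and a value below L at T.
  let m := -((6 * K ^ 2 + T + c) * T) - (K + 1) / T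
  have hK : 0 ≤ K := by positivity
  have hm : m + (6 * K ^ 2 + T + c) * T = -((K + 1) / T) := by simp only [m]; ring
  have hKT : 0 < (K + 1) / T := by positivity
  have hB : 0 ≤ (6 * K ^ 2 + T + c) * T :=
    mul_nonneg (by nlinarith [F.c_nonneg, sq_nonneg K]) hT.le
  have hm0 : m < 0 := by linarith
  have hbd : ∀ t ∈ Icc 0 T, t ∈ F.D m → F.u m t ≤ y₀ → |F.u m t| ≤ K := by
    intro t ht htD hle
    refine abs_le.2 ⟨?_, ?_⟩
    · have := hcon m t ht htD
      simp only [K]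
      linarith [neg_abs_le L, abs_nonneg y₀]
    · simp only [K]
      linarith [le_abs_self y₀, abs_nonneg L]
  have hle : ∀ t ∈ Icc 0 T, t ∈ F.D m → F.u m t ≤ y₀ := by
    intro t ht htD
    by_contra! hlt
    have ht0 : 0 < t := ht.1.lt_of_ne fun h ↦ by rw [← h, F.u_zero] at hlt; exact lt_irrefl _ hlt
    obtain ⟨t₀, ht₀, hz, hpos⟩ := exists_first_zero (u := fun t ↦ y₀ - F.u m t) ht0
      (continuousOn_const.sub ((F.continuousOn_u m).mono (F.Icc_subset htD)))
      (eventually_nhdsGT_pos_of_deriv_pos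
        ((F.hasDerivAt_u m 0 (F.zero_mem m)).const_sub y₀) (by simp [F.u_zero])
        (by rw [F.v_zero]; linarith)) (by linarith)
    have hsub : Icc 0 t₀ ⊆ Icc 0 t := Icc_subset_Icc_right ht₀.2
    have h := F.le_initial_add (K := K) ht₀.1.le (ht₀.2.trans ht.2)
      (F.Icc_subset htD ⟨ht₀.1.le, ht₀.2⟩) (fun z hz' ↦ by
        refine hbd z ⟨hz'.1, (hsub hz').2.trans ht.2⟩ (F.Icc_subset htD (hsub hz')) ?_
        rcases hz'.1.eq_or_lt with rfl | h1
        · exact (F.u_zero m).le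
        rcases hz'.2.eq_or_lt with rfl | h2
        · linarith
        linarith [hpos z ⟨h1, h2⟩])
    rw [hm] at h
    nlinarith [mul_pos hKT ht₀.1]
  have hTD := F.mem_of_bddAbove hT.le hle
  have h := F.le_initial_add (K := K) hT.le le_rfl hTD fun z hz ↦
    hbd z hz (F.Icc_subset hTD hz) (hle z hz (F.Icc_subset hTD hz))
  rw [hm, neg_mul, div_mul_cancel₀ _ hT.ne'] at h
  have := hcon m T (right_mem_Icc.2 hT.le) hTD
  simp only [K] at h
  linarith [le_abs_self y₀, neg_abs_le L]

/-- A solution that gets below a level crosses it later. -/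
theorem exists_eq_of_lt (ht : 0 ≤ t) (htD : t ∈ F.D m) (hlt : F.u m t < b) :
    ∃ T, t < T ∧ T ∈ F.D m ∧ F.u m T = b := by
  by_contra! hcon
  have hbelow : ∀ z, t < z → z ∈ F.D m → F.u m z < b := by
    intro z hz hzD
    by_contra! hle
    obtain ⟨x, hx, hxb⟩ := intermediate_value_Icc hz.le
      ((F.continuousOn_u m).mono (F.Icc_subset' ht hzD)) ⟨hlt.le, hle⟩
    have hx1 : t < x := hx.1.lt_of_ne fun h ↦ by rw [← h] at hxb; linarith
    exact hcon x hx1 (F.Icc_subset' ht hzD hx) hxb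
  have hall : ∀ T, 0 ≤ T → T ∈ F.D m := by
    intro T hT
    refine F.mem_of_bddAbove hT (K := max y₀ b) fun z hz hzD ↦ ?_
    rcases le_or_gt z t with h | h
    · exact (F.le_max hz.1 h htD).trans (max_le_max le_rfl hlt.le)
    · exact (hbelow z h hzD).le.trans (le_max_right _ _)
  obtain ⟨T₂, hT₂⟩ := F.exists_time_bound b
  have h0 : 0 ≤ t + |T₂| + 1 := by positivity
  have := hT₂ (t + |T₂| + 1) m h0 (hall _ h0)
    (hbelow _ (by linarith [abs_nonneg T₂]) (hall _ h0)).le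
  linarith [le_abs_self T₂]

/-! ### Dependence on the slope -/

/-- Grönwall up to the first time at which the difference reaches ε shows that it never does; the
resulting upper bound also yields existence up to T. -/
theorem eventually_abs_sub_lt (hT : 0 ≤ T) (hTD : T ∈ F.D m) (hε : 0 < ε) :
    ∀ᶠ m' in 𝓝 m, T ∈ F.D m' ∧ ∀ t ∈ Icc 0 T, |F.u m' t - F.u m t| < ε := by
  wlog hε1 : ε ≤ 1 generalizing ε
  · filter_upwards [this one_pos le_rfl] with m' hm'
    exact ⟨hm'.1, fun t ht ↦ (hm'.2 t ht).trans (not_le.1 hε1)⟩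
  obtain ⟨K, hK⟩ := isCompact_Icc.exists_bound_of_continuousOn
    ((F.continuousOn_u m).mono (F.Icc_subset hTD))
  have hK0 : 0 ≤ K := (norm_nonneg _).trans (hK 0 (left_mem_Icc.2 hT))
  let C := 12 * (K + 1)
  have hC : 0 ≤ C := by positivity
  have hcont : Tendsto (fun m' ↦ Real.exp ((1 + C) * T) * (m' - m) ^ 2) (𝓝 m) (𝓝 0) := by
    have : Continuous fun m' ↦ Real.exp ((1 + C) * T) * (m' - m) ^ 2 := by fun_prop
    simpa using this.tendsto m
  filter_upwards [hcont.eventually (gt_mem_nhds (pow_pos hε 2))] with m' hm'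
  have hclose : ∀ t ∈ Icc 0 T, t ∈ F.D m' → |F.u m' t - F.u m t| < ε := by
    intro t ht htD'
    have htD := F.Icc_subset hTD ht
    by_contra! hle
    have ht0 : 0 < t := ht.1.lt_of_ne fun h ↦ by
      rw [← h, F.u_zero, F.u_zero] at hle
      simp only [sub_self, abs_zero] at hle
      linarith
    have hcd : ContinuousOn (fun z ↦ F.u m' z - F.u m z) (Icc 0 t) :=
      ((F.continuousOn_u m').mono (F.Icc_subset htD')).sub
        ((F.continuousOn_u m).mono (F.Icc_subset htD))
    have h0c : ContinuousAt (fun z ↦ ε - |F.u m' z - F.u m z|) 0 :=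
      continuousAt_const.sub
        (F.hasDerivAt_u_sub (F.zero_mem m') (F.zero_mem m)).continuousAt.abs
    obtain ⟨t₀, ht₀, hz, hpos⟩ := exists_first_zero (u := fun z ↦ ε - |F.u m' z - F.u m z|) ht0
      (continuousOn_const.sub hcd.abs)
      ((h0c.eventually (lt_mem_nhds (by simpa [F.u_zero] using hε))).filter_mono
        nhdsWithin_le_nhds) (sub_nonpos.2 hle)
    have hi' : ∀ z ∈ Icc 0 t₀, z ∈ F.D m' := fun z hz ↦
      F.Icc_subset htD' ⟨hz.1, hz.2.trans ht₀.2⟩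
    have hi : ∀ z ∈ Icc 0 t₀, z ∈ F.D m := fun z hz ↦ F.Icc_subset htD ⟨hz.1, hz.2.trans ht₀.2⟩
    have hq : ∀ z ∈ Icc 0 t₀, |12 * ((F.u m' z + F.u m z) / 2)| ≤ C := by
      intro z hz'
      have h1 : |F.u m' z - F.u m z| ≤ 1 := by
        refine le_trans ?_ hε1
        rcases hz'.1.eq_or_lt with rfl | h1
        · simpa [F.u_zero] using hε.le
        rcases hz'.2.eq_or_lt with rfl | h2
        · linarith
        linarith [hpos z ⟨h1, h2⟩]
      have h2 := abs_le.1 h1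
      have h3 := abs_le.1 (hK z ⟨hz'.1, hz'.2.trans (ht₀.2.trans ht.2)⟩)
      simp only [C]
      exact abs_le.2 ⟨by linarith [h2.1, h3.1], by linarith [h2.2, h3.2]⟩
    have he := energy_le_forward ht₀.1.le
      (fun z hz ↦ F.hasDerivAt_u_sub (hi' z hz) (hi z hz))
      (fun z hz ↦ F.hasDerivAt_v_sub (hi' z hz) (hi z hz)) hq
    simp only [F.u_zero, F.v_zero, sub_self, sub_zero] at he
    have h1 : Real.exp ((1 + C) * t₀) ≤ Real.exp ((1 + C) * T) := by
      gcongr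
      exact ht₀.2.trans ht.2
    have h2 : ε ^ 2 = (F.u m' t₀ - F.u m t₀) ^ 2 := by
      rw [← sq_abs (F.u m' t₀ - F.u m t₀), ← sub_eq_zero.1 hz]
    nlinarith [sq_nonneg (F.v m' t₀ - F.v m t₀), mul_le_mul_of_nonneg_right h1
      (sq_nonneg (m' - m))]
  have hTD' : T ∈ F.D m' := F.mem_of_bddAbove hT (K := K + ε) fun t ht htD' ↦ by
    linarith [(abs_lt.1 (hclose t ht htD')).2, (abs_le.1 (hK t ht)).2]
  exact ⟨hTD', fun t ht ↦ hclose t ht (F.Icc_subset hTD' ht)⟩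

theorem exists_gt_of_not_mem (hT : 0 ≤ T) (hTD : T ∉ F.D m) (K : ℝ) :
    ∃ t ∈ Ico 0 T, t ∈ F.D m ∧ K < F.u m t := by
  by_contra! hcon
  refine hTD (F.mem_of_bddAbove hT (K := K) fun t ht htD ↦ hcon t ⟨ht.1, ?_⟩ htD)
  exact ht.2.lt_of_ne fun h ↦ hTD (h ▸ htD)

/-- The condition that `u m` has blown up before `T` or is above `b` at `T` is open. -/
theorem eventually_above (hT : 0 < T) (h : T ∈ F.D m → b < F.u m T) :
    ∀ᶠ z : ℝ × ℝ in 𝓝 (T, m), z.1 ∈ F.D z.2 → b < F.u z.2 z.1 := by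
  rw [nhds_prod_eq]
  by_cases hTD : T ∈ F.D m
  · have hκ : 0 < (F.u m T - b) / 2 := by linarith [h hTD]
    have hev : ∀ᶠ t in 𝓝 T, t ∈ F.D m ∧ b + (F.u m T - b) / 2 < F.u m t :=
      ((F.isOpen_D m).eventually_mem hTD).and
        ((F.hasDerivAt_u m T hTD).continuousAt.eventually (lt_mem_nhds (by linarith)))
    obtain ⟨η, hη, hball⟩ := Metric.eventually_nhds_iff.1 hev
    have hT₂ : T + η / 2 ∈ F.D m := (hball (by
      rw [Real.dist_eq, add_sub_cancel_left, abs_of_pos (half_pos hη)]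
      linarith)).1
    have hI : ∀ᶠ t in 𝓝 T, t ∈ Ioo (max 0 (T - η / 2)) (T + η / 2) :=
      Ioo_mem_nhds (max_lt hT (by linarith)) (by linarith)
    filter_upwards [hI.prod_mk (F.eventually_abs_sub_lt (by linarith) hT₂ hκ)]
    rintro ⟨t, m'⟩ ⟨ht, -, hm'⟩ -
    obtain ⟨h0, h1⟩ := max_lt_iff.1 ht.1
    have h2 := hm' t ⟨h0.le, ht.2.le⟩
    have h3 := (hball (y := t) (by
      rw [Real.dist_eq, abs_lt]
      constructor <;> linarith [ht.2])).2
    linarith [(abs_lt.1 h2).1]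
  -- On its way to blow-up the solution exceeds both b and y₀ at some t₁ < T. Nearby ones do so as
  -- well at t₁, and by convexity do not come down again.
  · obtain ⟨t₁, ht₁, ht₁D, hgt⟩ := F.exists_gt_of_not_mem hT.le hTD (max b y₀)
    filter_upwards [(lt_mem_nhds ht₁.2).prod_mk
      (F.eventually_abs_sub_lt ht₁.1 ht₁D (sub_pos.2 hgt))]
    rintro ⟨t, m'⟩ ⟨ht, ht₁D', hm'⟩ htD
    have h1 := (abs_lt.1 (hm' t₁ (right_mem_Icc.2 ht₁.1))).1
    have h2 : max b y₀ < F.u m' t₁ := by linarith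
    exact ((le_max_left _ _).trans_lt h2).trans_le
      (F.le_of_initial_lt ht₁.1 (le_of_lt ht) htD ((le_max_right _ _).trans_lt h2))

theorem isOpen_above (hT : 0 < T) (b : ℝ) : IsOpen {m | T ∈ F.D m → b < F.u m T} :=
  isOpen_iff_mem_nhds.2 fun m hm ↦
    ((by fun_prop : Continuous fun m : ℝ ↦ (T, m)).tendsto m).eventually (F.eventually_above hT hm)

theorem isOpen_below (hT : 0 ≤ T) (b : ℝ) : IsOpen {m | T ∈ F.D m ∧ F.u m T < b} := by
  refine isOpen_iff_mem_nhds.2 fun m hm ↦ ?_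
  filter_upwards [F.eventually_abs_sub_lt hT hm.1 (sub_pos.2 hm.2)] with m' hm'
  exact ⟨hm'.1, by linarith [(abs_lt.1 (hm'.2 T (right_mem_Icc.2 hT))).2]⟩

/-- Two solutions of the Dirichlet problem, one on each side of a slope that undershoots. -/
theorem exists_two_of_lt (hT : 0 < T) (hTD : T ∈ F.D m) (hlt : F.u m T < b) :
    ∃ m₂ < m, ∃ m₁ > m, (T ∈ F.D m₂ ∧ F.u m₂ T = b) ∧ (T ∈ F.D m₁ ∧ F.u m₁ T = b) := by
  obtain ⟨N, hN, hbound⟩ := F.exists_slope_bound hT T b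
  have key : ∀ (S : Set ℝ) (m' : ℝ), IsPreconnected S → m ∈ S → m' ∈ S → N < |m'| →
      ∃ z ∈ S, z ≠ m ∧ T ∈ F.D z ∧ F.u z T = b := by
    intro S m' hS hm hm' hgt
    by_contra! hcon
    -- Without a solution in `S`, the open conditions "below b at T" and "above b or blown up" would
    -- disconnect `S`; the second one holds at `m'` by the slope bound.
    obtain ⟨z, -, hz1, hz2⟩ := hS _ _ (F.isOpen_below hT.le b) (F.isOpen_above hT b)
      (fun z hz ↦ by
        by_cases h : T ∈ F.D z ∧ F.u z T < b
        · exact Or.inl h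
        · refine Or.inr fun hzD ↦ lt_of_le_of_ne (not_lt.1 fun h' ↦ h ⟨hzD, h'⟩) fun he ↦ ?_
          refine hcon z hz (fun hzm ↦ ?_) hzD he.symm
          rw [hzm] at he
          linarith)
      ⟨m, hm, hTD, hlt⟩ ⟨m', hm', fun hD ↦ by
        by_contra! hle
        exact absurd (hbound T m' le_rfl le_rfl hD hle) (not_le.2 hgt)⟩
    exact absurd (hz2 hz1.1) (not_lt.2 hz1.2.le)
  obtain ⟨m₂, h₂, hne₂, hs₂⟩ := key (Iic m) (-(|m| + N + 1)) isPreconnected_Iic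
    self_mem_Iic (by simp only [mem_Iic]; linarith [neg_abs_le m])
    (by rw [abs_neg, abs_of_pos (by positivity)]; linarith [abs_nonneg m])
  obtain ⟨m₁, h₁, hne₁, hs₁⟩ := key (Ici m) (|m| + N + 1) isPreconnected_Ici
    self_mem_Ici (by simp only [mem_Ici]; linarith [le_abs_self m])
    (by rw [abs_of_pos (by positivity)]; linarith [abs_nonneg m])
  exact ⟨m₂, lt_of_le_of_ne h₂ hne₂, m₁, lt_of_le_of_ne h₁ hne₁.symm, hs₂, hs₁⟩

end ShootingFamily

/-! ### Comparison with subsolutions and the threshold length -/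

theorem exists_neg_of_second_deriv_neg {f f' : ℝ → ℝ} {a b k : ℝ} (hab : a < b)
    (hf : ∀ t ∈ Icc a b, HasDerivAt f (f' t) t) (hf' : HasDerivAt f' k a) (h0 : f a = 0)
    (h0' : f' a = 0) (hk : k < 0) : ∃ t ∈ Ioo a b, f t < 0 := by
  have hev := eventually_nhdsGT_pos_of_deriv_pos hf'.neg (by simp [h0']) (by linarith)
  obtain ⟨r, hr, hpos⟩ := mem_nhdsGT_iff_exists_Ioo_subset.1 hev
  obtain ⟨t, hat, ht⟩ := exists_between (lt_min hab (mem_Ioi.1 hr))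
  obtain ⟨htb, htr⟩ := lt_min_iff.1 ht
  refine ⟨t, ⟨hat, htb⟩, ?_⟩
  have h := lt_of_hasDerivAt_pos hat (fun z hz ↦ (hf z ⟨hz.1, hz.2.trans htb.le⟩).neg)
    (fun z hz ↦ hpos ⟨hz.1, hz.2.trans htr⟩)
  simp only [Pi.neg_apply, h0] at h
  linarith

namespace ShootingFamily

variable {c y₀ : ℝ} (F : ShootingFamily c y₀) {m m₁ m₂ T b : ℝ}

/-- Comparison with a strict subsolution `w` starting below `y₀`: some solution gets to or below
the value of `w` at the right end. -/
theorem exists_le_of_subsolution {w w' w'' : ℝ → ℝ} (hT : 0 < T)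
    (hw : ∀ t ∈ Icc 0 T, HasDerivAt w (w' t) t) (hw' : ∀ t ∈ Icc 0 T, HasDerivAt w' (w'' t) t)
    (hsub : ∀ t ∈ Icc 0 T, 6 * w t ^ 2 + t + c < w'' t) (hw0 : ∀ t ∈ Icc 0 T, w t < y₀) :
    ∃ m, T ∈ F.D m ∧ F.u m T ≤ w T := by
  by_contra! hno
  have hcw : ContinuousOn w (Icc 0 T) :=
    fun t ht ↦ (hw t ht).continuousAt.continuousWithinAt
  let S : Set ℝ := {m | ∀ t ∈ Icc 0 T, t ∈ F.D m → w t < F.u m t}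
  have hSopen : IsOpen S := by
    refine isOpen_iff_mem_nhds.2 fun m hm ↦ ?_
    -- Continuous dependence is needed only up to t₁: either t₁ = T, or u(t₁) > y₀ and convexity
    -- keeps nearby solutions above y₀ > w afterwards.
    obtain ⟨t₁, ht₁, ht₁D, hor⟩ : ∃ t ∈ Icc 0 T, t ∈ F.D m ∧ (t = T ∨ y₀ < F.u m t) := by
      by_cases hTD : T ∈ F.D m
      · exact ⟨T, right_mem_Icc.2 hT.le, hTD, Or.inl rfl⟩
      · obtain ⟨t, ht, htD, h⟩ := F.exists_gt_of_not_mem hT.le hTD y₀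
        exact ⟨t, Ico_subset_Icc_self ht, htD, Or.inr h⟩
    have hsubI : Icc 0 t₁ ⊆ Icc 0 T := Icc_subset_Icc_right ht₁.2
    obtain ⟨z, hz, hmin⟩ := isCompact_Icc.exists_isMinOn (nonempty_Icc.2 ht₁.1)
      (((F.continuousOn_u m).mono (F.Icc_subset ht₁D)).sub (hcw.mono hsubI))
    have hκ : 0 < F.u m z - w z := sub_pos.2 (hm z (hsubI hz) (F.Icc_subset ht₁D hz))
    have hmin' : ∀ t ∈ Icc 0 t₁, F.u m z - w z ≤ F.u m t - w t := fun t ht ↦ hmin ht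
    have hε : 0 < if y₀ < F.u m t₁ then min (F.u m z - w z) (F.u m t₁ - y₀)
        else F.u m z - w z := by
      split_ifs with h
      · exact lt_min hκ (sub_pos.2 h)
      · exact hκ
    filter_upwards [F.eventually_abs_sub_lt ht₁.1 ht₁D hε] with m' hm' t ht htD'
    rcases le_or_gt t t₁ with h | h
    · have h1 : |F.u m' t - F.u m t| < F.u m z - w z := by
        refine (hm'.2 t ⟨ht.1, h⟩).trans_le ?_
        split_ifs
        · exact min_le_left _ _
        · exact le_rfl
      linarith [hmin' t ⟨ht.1, h⟩, (abs_lt.1 h1).1]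
    · have hy : y₀ < F.u m t₁ := hor.resolve_left fun he ↦ by linarith [ht.2]
      have h1 := hm'.2 t₁ (right_mem_Icc.2 ht₁.1)
      rw [if_pos hy] at h1
      have h2 := (abs_lt.1 (h1.trans_le (min_le_right _ _))).1
      have h3 := F.le_of_initial_lt ht₁.1 h.le htD' (by linarith)
      linarith [hw0 t ht]
  have hScompl : IsOpen Sᶜ := by
    refine isOpen_iff_mem_nhds.2 fun m hm ↦ ?_
    -- Mere contact with w is impossible: it would be an interior minimum of u - w, since `hw0`
    -- excludes 0 and `hno` excludes T, yet there (u - w)'' = 6w² + t + c - w'' < 0. Being strictly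
    -- below w is open in m.
    obtain ⟨t, ht, htD, hlt⟩ : ∃ t ∈ Icc 0 T, t ∈ F.D m ∧ F.u m t < w t := by
      by_contra! hge
      simp only [S, mem_compl_iff, mem_ofPred_eq, not_forall, not_lt] at hm
      obtain ⟨t, ht, htD, hle⟩ := hm
      have heq : F.u m t - w t = 0 := by linarith [hge t ht htD]
      have ht0 : 0 < t := ht.1.lt_of_ne fun h ↦ by
        have := hw0 t ht
        rw [← h, F.u_zero] at heq
        rw [← h] at this
        linarith
      have htT : t < T := ht.2.lt_of_ne fun h ↦ by
        rw [h] at htD heq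
        linarith [hno m htD]
      have hd : ∀ z ∈ Icc 0 T, z ∈ F.D m →
          HasDerivAt (fun t ↦ F.u m t - w t) (F.v m z - w' z) z :=
        fun z hz hzD ↦ (F.hasDerivAt_u m z hzD).sub (hw z hz)
      have hloc : IsLocalMin (fun t ↦ F.u m t - w t) t := by
        filter_upwards [Ioo_mem_nhds ht0 htT, (F.isOpen_D m).mem_nhds htD] with z hz hzD
        rw [heq]
        exact sub_nonneg.2 (hge z (Ioo_subset_Icc_self hz) hzD)
      obtain ⟨p, htp, hpD⟩ : ∃ p, t < p ∧ Ico t p ⊆ F.D m :=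
        exists_Ico_subset_of_mem_nhds ((F.isOpen_D m).mem_nhds htD) ⟨T, htT⟩
      obtain ⟨q, htq, hq⟩ := exists_between (lt_min htp htT)
      obtain ⟨hqp, hqT⟩ := lt_min_iff.1 hq
      have hqI : ∀ z ∈ Icc t q, z ∈ Icc 0 T := fun z hz ↦ ⟨ht.1.trans hz.1, hz.2.trans hqT.le⟩
      have hqD : ∀ z ∈ Icc t q, z ∈ F.D m := fun z hz ↦ hpD ⟨hz.1, hz.2.trans_lt hqp⟩
      have hwt : w t = F.u m t := by linarith
      obtain ⟨z, hz, hneg⟩ := exists_neg_of_second_deriv_neg htq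
        (fun z hz ↦ hd z (hqI z hz) (hqD z hz))
        ((F.hasDerivAt_v m t htD).sub (hw' t ht)) heq (hloc.hasDerivAt_eq_zero (hd t ht htD))
        (by have := hsub t ht; rw [hwt] at this; linarith)
      have hz' := Ioo_subset_Icc_self hz
      linarith [hge z (hqI z hz') (hqD z hz')]
    filter_upwards [F.eventually_abs_sub_lt ht.1 htD (sub_pos.2 hlt)] with m' hm' hcon
    linarith [(abs_lt.1 (hm'.2 t (right_mem_Icc.2 ht.1))).2, hcon t ht (F.Icc_subset hm'.1
      (right_mem_Icc.2 ht.1))]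
  have hS0 : (0 : ℝ) ∈ S := fun t ht htD ↦ by
    have := F.initial_tangent ht.1 htD
    linarith [hw0 t ht]
  have huniv : S = univ := IsClopen.eq_univ ⟨isOpen_compl_iff.1 hScompl, hSopen⟩ ⟨0, hS0⟩
  obtain ⟨L, hL⟩ := isCompact_Icc.exists_bound_of_continuousOn hcw
  obtain ⟨m, t, ht, htD, hlt⟩ := F.exists_lt hT (-L)
  have hmS : m ∈ S := huniv ▸ mem_univ m
  linarith [hmS t ht htD, (abs_le.1 (hL t ht)).1]

/-- If the level `b` is reached at some time, then it is undershot at all earlier times. -/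
theorem exists_undershoot {T' : ℝ} (hT : 0 < T) (hTT' : T < T') (hD : T' ∈ F.D m)
    (hb : F.u m T' = b) : ∃ m', T ∈ F.D m' ∧ F.u m' T < b := by
  rcases lt_or_ge y₀ b with hyb | hyb
  · refine ⟨m, F.Icc_subset hD ⟨hT.le, hTT'.le⟩, ?_⟩
    have h := F.chord le_rfl hT.le hTT'.le hD
    rw [F.u_zero, hb] at h
    by_contra! hcon
    nlinarith
  have hδ : 0 < T' - T := sub_pos.2 hTT'
  obtain ⟨K, hK⟩ := isCompact_Icc.exists_bound_of_continuousOn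
    ((F.continuousOn_u m).mono (F.Icc_subset hD))
  have hK0 : 0 ≤ K := (norm_nonneg _).trans (hK 0 (left_mem_Icc.2 (hT.trans hTT').le))
  -- Shifting time gains T' - T in the forcing term; lowering by ε ≤ 1 costs at most (12K + 6)ε, so
  -- 7 in place of 6 makes the subsolution strict.
  let ε := min 1 ((T' - T) / (12 * K + 7))
  have hε : 0 < ε := lt_min one_pos (by positivity)
  have hε1 : ε ≤ 1 := min_le_left _ _
  have hε2 : ε * (12 * K + 7) ≤ T' - T := (le_div_iff₀ (by positivity)).1 (min_le_right _ _)
  have hmem : ∀ t ∈ Icc 0 T, t + (T' - T) ∈ Icc 0 T' :=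
    fun t ht ↦ ⟨by linarith [ht.1], by linarith [ht.2]⟩
  obtain ⟨m', hm'D, hle⟩ := F.exists_le_of_subsolution (w := fun t ↦ F.u m (t + (T' - T)) - ε)
    (w' := fun t ↦ F.v m (t + (T' - T)))
    (w'' := fun t ↦ 6 * F.u m (t + (T' - T)) ^ 2 + (t + (T' - T)) + c) hT
    (fun t ht ↦ ((F.hasDerivAt_u m _ (F.Icc_subset hD (hmem t ht))).comp_add_const t
      (T' - T)).sub_const ε)
    (fun t ht ↦ (F.hasDerivAt_v m _ (F.Icc_subset hD (hmem t ht))).comp_add_const t (T' - T))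
    (fun t ht ↦ by
      have h1 := (abs_le.1 (hK _ (hmem t ht))).1
      nlinarith)
    (fun t ht ↦ by
      have h1 := F.le_max (hmem t ht).1 (hmem t ht).2 hD
      rw [hb, max_eq_left hyb] at h1
      linarith)
  refine ⟨m', hm'D, ?_⟩
  rw [add_sub_cancel, hb] at hle
  linarith

/-- The longest interval on which the Dirichlet problem `u(0) = y₀`, `u(T) = b` is solvable, and
the number of its solutions. -/
theorem exists_threshold (b : ℝ) : ∃ T₀ > 0,
    (∀ m T, 0 < T → T ∈ F.D m → F.u m T = b → T ≤ T₀) ∧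
    (∃! m, T₀ ∈ F.D m ∧ F.u m T₀ = b) ∧
    ∀ T, 0 < T → T < T₀ →
      ∃ m₁ m₂, m₁ ≠ m₂ ∧ ∀ m, (T ∈ F.D m ∧ F.u m T = b) ↔ m = m₁ ∨ m = m₂ := by
  let A : Set ℝ := {T | 0 < T ∧ ∃ m, T ∈ F.D m ∧ F.u m T = b}
  have hcross : ∀ {m T}, 0 ≤ T → T ∈ F.D m → F.u m T < b → ∃ T' ∈ A, T < T' := by
    intro m T hT hTD hlt
    obtain ⟨T', hTT', hD', hb'⟩ := F.exists_eq_of_lt hT hTD hlt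
    exact ⟨T', ⟨hT.trans_lt hTT', m, hD', hb'⟩, hTT'⟩
  have hne : A.Nonempty := by
    obtain ⟨m, t, ht, htD, hlt⟩ := F.exists_lt one_pos b
    obtain ⟨T', hT', -⟩ := hcross ht.1 htD hlt
    exact ⟨T', hT'⟩
  have hbdd : BddAbove A := by
    obtain ⟨T₂, hT₂⟩ := F.exists_time_bound b
    exact ⟨T₂, fun T ⟨hT, m, hD, hb⟩ ↦ hT₂ T m hT.le hD hb.le⟩
  have hlub : IsLUB A (sSup A) := isLUB_csSup hne hbdd
  set T₀ := sSup A with hT₀def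
  have hT₀ : 0 < T₀ := by
    obtain ⟨T, hT⟩ := hne
    exact hT.1.trans_le (hlub.1 hT)
  have hmax : ∀ m T, 0 < T → T ∈ F.D m → F.u m T = b → T ≤ T₀ :=
    fun m T hT hD hb ↦ hlub.1 ⟨hT, m, hD, hb⟩
  have hnolt : ∀ m, T₀ ∈ F.D m → b ≤ F.u m T₀ := by
    intro m hD
    by_contra! hlt
    obtain ⟨T', hT', hgt⟩ := hcross hT₀.le hD hlt
    exact absurd (hlub.1 hT') (not_le.2 hgt)
  have hatt : ∃ m, T₀ ∈ F.D m ∧ F.u m T₀ = b := by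
    by_contra! hcon
    obtain ⟨N, hN, hbound⟩ := F.exists_slope_bound (half_pos hT₀) T₀ b
    -- If T₀ were not attained, every slope would be above b or blown up at T₀; compactness of the
    -- slope range extends this to all T near T₀, among them times in `A`.
    have hev : ∀ᶠ T in 𝓝 T₀, ∀ m ∈ Icc (-N) N, T ∈ F.D m → b < F.u m T :=
      isCompact_Icc.eventually_forall_of_forall_eventually fun m _ ↦
        F.eventually_above hT₀ fun hD ↦ lt_of_le_of_ne (hnolt m hD) (hcon m hD).symm
    obtain ⟨T, hTA, hT⟩ := ((hlub.frequently_mem hne).and_eventually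
      ((hev.and (lt_mem_nhds (half_lt_self hT₀))).filter_mono nhdsWithin_le_nhds)).exists
    obtain ⟨hT0, m, hD, hb⟩ := hTA
    have hm := hbound T m hT.2.le (hlub.1 ⟨hT0, m, hD, hb⟩) hD hb.le
    exact absurd hb (hT.1 m (abs_le.1 hm) hD).ne'
  refine ⟨T₀, hT₀, hmax, ?_, fun T hT hTT₀ ↦ ?_⟩
  · have huniq : ∀ m₁ m₂, m₂ < m₁ → T₀ ∈ F.D m₁ → F.u m₁ T₀ = b → T₀ ∈ F.D m₂ →
        F.u m₂ T₀ ≠ b := by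
      intro m₁ m₂ hlt h₁ hb₁ h₂ hb₂
      obtain ⟨m, hm₂, hm₁⟩ := exists_between hlt
      obtain ⟨hD, h⟩ := F.lt_of_between hT₀ hm₂ hm₁ h₁ h₂ (hb₁.trans hb₂.symm)
      linarith [hnolt m hD]
    obtain ⟨m, hD, hb⟩ := hatt
    refine ⟨m, ⟨hD, hb⟩, fun m' ⟨hD', hb'⟩ ↦ ?_⟩
    rcases lt_trichotomy m' m with h | h | h
    · exact absurd hb' (huniq m m' h hD hb hD')
    · exact h
    · exact absurd hb (huniq m' m h hD' hb' hD)
  · obtain ⟨m₀, hD₀, hb₀⟩ := hatt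
    obtain ⟨m, hD, hlt⟩ := F.exists_undershoot hT hTT₀ hD₀ hb₀
    obtain ⟨m₂, hm₂, m₁, hm₁, ⟨h₂, hb₂⟩, h₁, hb₁⟩ := F.exists_two_of_lt hT hD hlt
    have hbet : ∀ {p q r}, p < q → q < r → T ∈ F.D r → F.u r T = b → T ∈ F.D p → F.u p T = b →
        F.u q T ≠ b := by
      intro p q r hpq hqr hr hbr hp hbp
      exact ((F.lt_of_between hT hpq hqr hr hp (hbr.trans hbp.symm)).2.trans_eq hbr).ne
    refine ⟨m₁, m₂, (hm₂.trans hm₁).ne', fun z ↦ ⟨fun ⟨hz, hbz⟩ ↦ ?_, ?_⟩⟩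
    · have h21 : m₂ < m₁ := hm₂.trans hm₁
      rcases lt_trichotomy z m₂ with h | h | h
      · exact absurd hb₂ (hbet h h21 h₁ hb₁ hz hbz)
      · exact Or.inr h
      rcases lt_trichotomy z m₁ with h' | h' | h'
      · exact absurd hbz (hbet h h' h₁ hb₁ h₂ hb₂)
      · exact Or.inl h'
      · exact absurd hb₁ (hbet h21 h' hz hbz h₂ hb₂)
    · rintro (rfl | rfl)
      exacts [⟨h₁, hb₁⟩, ⟨h₂, hb₂⟩]

end ShootingFamily

/-! ### Back to the first Painlevé equation -/

namespace P1Solution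

/-- The maximal solution with `y(p) = a`, `y'(p) = v`. -/
noncomputable def ofCauchyData (p a v : ℝ) : P1Solution := (exists_cauchyData p a v).choose

variable (p a v : ℝ)

theorem mem_dom_ofCauchyData : p ∈ (ofCauchyData p a v).dom :=
  (exists_cauchyData p a v).choose_spec.1

theorem ofCauchyData_apply : (ofCauchyData p a v).toFun p = a :=
  (exists_cauchyData p a v).choose_spec.2.1

theorem deriv_ofCauchyData : deriv (ofCauchyData p a v).toFun p = v :=
  (exists_cauchyData p a v).choose_spec.2.2

theorem eq_ofCauchyData {p a : ℝ} (y : P1Solution) (h : y.PassesThrough p a) :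
    y = ofCauchyData p a (deriv y.toFun p) :=
  ext_of_cauchyData h.1 (mem_dom_ofCauchyData _ _ _) (by rw [ofCauchyData_apply, h.2])
    (by rw [deriv_ofCauchyData])

end P1Solution

/-- The solutions through `(x₀, y₀)`, continued to the left, in the variable `t = x₀ - x`. -/
noncomputable def ShootingFamily.ofP1 (x₀ y₀ : ℝ) (hx₀ : x₀ ≤ 0) : ShootingFamily (-x₀) y₀ where
  D m := {t | x₀ - t ∈ (P1Solution.ofCauchyData x₀ y₀ (-m)).dom}
  u m t := (P1Solution.ofCauchyData x₀ y₀ (-m)).toFun (x₀ - t)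
  v m t := -deriv (P1Solution.ofCauchyData x₀ y₀ (-m)).toFun (x₀ - t)
  c_nonneg := by linarith
  isOpen_D m := (P1Solution.isOpen_dom _).preimage (continuous_sub_left x₀)
  ordConnected_D m := ⟨fun s hs t ht z hz ↦
    (P1Solution.ordConnected_dom _).out ht hs ⟨by linarith [hz.2], by linarith [hz.1]⟩⟩
  zero_mem m := by simpa using P1Solution.mem_dom_ofCauchyData x₀ y₀ (-m)
  u_zero m := by simp [P1Solution.ofCauchyData_apply]
  v_zero m := by simp [P1Solution.deriv_ofCauchyData]
  hasDerivAt_u m t ht := ((P1Solution.satisfies _).hasDerivAt ht).comp_const_sub x₀ t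
  hasDerivAt_v m t ht :=
    (((P1Solution.satisfies _ _ ht).2.comp_const_sub x₀ t).neg).congr_deriv (by ring)
  mem_of_bounded m T K hT hsub hK := by
    have hmem : ∀ x ∈ Ioc (x₀ - T) x₀, x₀ - x ∈ Ico 0 T :=
      fun x hx ↦ ⟨by linarith [hx.2], by linarith [hx.1]⟩
    refine P1Solution.mem_dom_of_bounded_right _ (p := x₀) (K := K) (by linarith)
      (fun x hx ↦ ?_) (fun x hx ↦ ?_)
    · simpa using hsub (hmem x hx)
    · simpa using hK _ (hmem x hx)

theorem mem_P1DirichletSolutions_iff {x₀ y₀ x₁ b : ℝ} (hx₀ : x₀ ≤ 0) (y : P1Solution) :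
    y ∈ P1DirichletSolutions x₀ y₀ x₁ b ↔ ∃ m, y = P1Solution.ofCauchyData x₀ y₀ (-m) ∧
      x₀ - x₁ ∈ (ShootingFamily.ofP1 x₀ y₀ hx₀).D m ∧
      (ShootingFamily.ofP1 x₀ y₀ hx₀).u m (x₀ - x₁) = b := by
  simp only [ShootingFamily.ofP1, mem_ofPred_eq, sub_sub_cancel]
  constructor
  · rintro ⟨h₀, h₁⟩
    refine ⟨-deriv y.toFun x₀, ?_⟩
    rw [neg_neg, ← y.eq_ofCauchyData h₀]
    exact ⟨rfl, h₁⟩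
  · rintro ⟨m, rfl, h₁⟩
    exact ⟨⟨P1Solution.mem_dom_ofCauchyData _ _ _, P1Solution.ofCauchyData_apply _ _ _⟩, h₁⟩

theorem injective_ofCauchyData_neg (x₀ y₀ : ℝ) :
    Function.Injective fun m ↦ P1Solution.ofCauchyData x₀ y₀ (-m) := by
  intro m m' h
  have h1 := congrArg (fun y : P1Solution ↦ deriv y.toFun x₀) h
  simpa [P1Solution.deriv_ofCauchyData] using h1

/-- Here `b` is the left boundary value. The first two clauses say that the infimum `P1Z x₀ y₀ b`
is a genuine one (of a nonempty set bounded below), and that it lies to the left of `x₀`. -/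
theorem theorem7p2 (x₀ y₀ b : ℝ) (hx₀ : x₀ ≤ 0) :
    IsGLB (P1LevelAbscissas x₀ y₀ b) (P1Z x₀ y₀ b) ∧
    P1Z x₀ y₀ b < x₀ ∧
    ∀ x₁ : ℝ, x₁ < x₀ →
      (x₁ < P1Z x₀ y₀ b → P1DirichletSolutions x₀ y₀ x₁ b = ∅) ∧
      (x₁ = P1Z x₀ y₀ b → ∃! y : P1Solution, y ∈ P1DirichletSolutions x₀ y₀ x₁ b) ∧
      (P1Z x₀ y₀ b < x₁ → (P1DirichletSolutions x₀ y₀ x₁ b).encard = 2) := by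
  obtain ⟨T₀, hT₀, hmax, huniq, htwo⟩ := (ShootingFamily.ofP1 x₀ y₀ hx₀).exists_threshold b
  have hiff := fun {x₁} (y : P1Solution) ↦
    mem_P1DirichletSolutions_iff (y₀ := y₀) (x₁ := x₁) (b := b) hx₀ y
  -- Abscissas z ≥ x₀ may belong to the set too, but only those below x₀ - T₀ could spoil the
  -- minimum, and they correspond to lengths beyond T₀.
  have hleast : IsLeast (P1LevelAbscissas x₀ y₀ b) (x₀ - T₀) := by
    constructor
    · obtain ⟨m, hm, -⟩ := huniq
      exact ⟨_, (hiff _).2 ⟨m, rfl, by rwa [sub_sub_cancel]⟩⟩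
    · rintro z ⟨y, hy⟩
      obtain ⟨m, -, hD, hb⟩ := (hiff y).1 hy
      by_contra! hlt
      linarith [hmax m (x₀ - z) (by linarith) hD hb]
  have hZ : P1Z x₀ y₀ b = x₀ - T₀ := hleast.csInf_eq
  rw [hZ]
  refine ⟨hleast.isGLB, by linarith, fun x₁ hx₁ ↦ ⟨fun hlt ↦ ?_, fun heq ↦ ?_, fun hlt ↦ ?_⟩⟩
  · refine eq_empty_of_forall_notMem fun y hy ↦ ?_
    exact absurd (hleast.2 ⟨y, hy⟩) (not_le.2 hlt)
  · obtain ⟨m, hm, hm'⟩ := huniq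
    have hT : x₀ - x₁ = T₀ := by linarith
    refine ⟨_, (hiff _).2 ⟨m, rfl, by rwa [hT]⟩, fun y hy ↦ ?_⟩
    obtain ⟨m', rfl, h⟩ := (hiff y).1 hy
    rw [hT] at h
    rw [hm' m' h]
  · obtain ⟨m₁, m₂, hne, h⟩ := htwo (x₀ - x₁) (by linarith) (by linarith)
    rw [encard_eq_two]
    refine ⟨_, _, (injective_ofCauchyData_neg x₀ y₀).ne hne, ?_⟩
    ext y
    rw [hiff y]
    simp only [h, mem_insert_iff, mem_singleton_iff]
    constructor
    · rintro ⟨m, rfl, rfl | rfl⟩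
      · exact Or.inl rfl
      · exact Or.inr rfl
    · rintro (rfl | rfl)
      · exact ⟨m₁, rfl, Or.inl rfl⟩
      · exact ⟨m₂, rfl, Or.inr rfl⟩
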